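/- Manifolds are smooth, Hausdorff and second countable, submanifolds are embedded, without boundary and not assumed closed. Equip $\mathbb R^3\times\mathbb R^{2n-2}$, with coordinates $(p,q,z,x,y)$, with the contact form $dz-p\,dq-\sum_i y_i\,dx_i$. A \emph{stabilization} is a compact smoothly embedded Legendrian arc $\gamma$ in $(\mathbb R^3,\ker(dz-p\,dq))$ whose front projection to the $(q,z)$-plane has a single transverse self-intersection and a single semicubical cusp as its only singularity, and which has a single Reeb chord (pair of points differing only in $z$); its \emph{action} $a$ is the length of this chord. Let $(V,\xi)$ be a manifold of dimension $2n+1$, $n\ge 1$, with a cooriented contact structure, and $L\subset V$ a Legendrian submanifold ($\dim L=n$). Say that a connected component $\Lambda_0$ of $L$ admits a loose chart in $V\setminus(L\setminus\Lambda_0)$ if there are a compact convex set $B\subset\mathbb R^3$ with nonempty interior, a stabilization $\gamma\subset B$ with action $a$, a number $\rho>0$ with $a/\rho^2<2$ if $n\ge 2$ (no condition on $\rho$ if $n=1$), a subset $U\subset V$, and a diffeomorphism $\varphi$ from an open neighbourhood of $U$ in $V$ which does not meet $L\setminus\Lambda_0$ onto an open subset of $\mathbb R^3\times\mathbb R^{2n-2}$,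 mapping $\xi$ to $\ker(dz-p\,dq-\sum_i y_i\,dx_i)$, such that $\varphi(U)=B\times[-\rho,\rho]^{2n-2}$ and $\varphi(U\cap \Lambda_0)=\{(p,q,z,x,y) : (p,q,z)\in\gamma,\ x\in[-\rho,\rho]^{n-1},\ y=0\}$. If every connected component of $L$ admits such a chart, $L$ is called \emph{loose} when $n\ge 2$, and \emph{stabilized} when $n=1$. The symplectization $SV$ is the submanifold of $T^*V$ of the covectors which define $\xi$ with its coorientation, with the restriction $\lambda$ of the canonical $1$-form of $T^*V$; its contactization $CSV$ is $SV\times\mathbb R$ with the contact form $\lambda+dt$. For a Legendrian submanifold $\Lambda\subset V$ let $S\Lambda\subset SV$ be its preimage under $SV\to V$, and let $CS\Lambda\subset CSV$ denote the graph of a primitive of $-\lambda|_{S\Lambda}$. \textbf{Proposition.} Let $\Lambda$ be a Legendrian submanifold of $(V,\xi)$ which is loose, or stabilized if $\dim\Lambda=1$. Then $S\Lambda$ is an exact Lagrangian submanifold of $SV$ (so that a primitive exists), and for every choice of the primitive of $-\lambda|_{S\Lambda}$ the lift $CS\Lambda$ is a loose Legendrian submanifold of $CSV$. -/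

import Mathlib

open Set Topology Manifold Bundle
open scoped ContDiff

noncomputable section

/-! ### The standard contact space and Legendrian stabilizations -/

/-- The space `ℝ³ × ℝ^m × ℝ^m`, with coordinates `((p, q, z), x, y)`. -/
abbrev LooseModel (m : ℕ) : Type := (ℝ × ℝ × ℝ) × (Fin m → ℝ) × (Fin m → ℝ)

/-- The standard contact form `dz - p dq - ∑ yᵢ dxᵢ` on `ℝ³ × ℝ^m × ℝ^m`, evaluated at the point `u`
on the tangent vector `w`. -/
def stdContactForm {m : ℕ} (u w : LooseModel m) : ℝ :=
  w.1.2.2 - u.1.1 * w.1.2.1 - ∑ i, u.2.2 i * w.2.1 i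

/-- The Legendrian arc `t ↦ (p t, q t, z t)`, `t ∈ [-1, 1]`, in `(ℝ³, ker (dz - p dq))` is a
stabilization with action `a`: it is smoothly embedded and Legendrian, its front projection
`t ↦ (q t, z t)` has a single transverse self-intersection and a single (semicubical) cusp as its
only singularity, and the arc has a single Reeb chord (a pair of points of the arc which differ
only by their `z`-coordinates), whose action (length) is `a`. -/
structure IsStabilization (p q z : ℝ → ℝ) (a : ℝ) : Prop where
  smooth : ContDiff ℝ ∞ p ∧ ContDiff ℝ ∞ q ∧ ContDiff ℝ ∞ z
  injective : ∀ s ∈ Icc (-1 : ℝ) 1, ∀ t ∈ Icc (-1 : ℝ) 1,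
    p s = p t → q s = q t → z s = z t → s = t
  immersed : ∀ t ∈ Icc (-1 : ℝ) 1, ¬ (deriv p t = 0 ∧ deriv q t = 0 ∧ deriv z t = 0)
  legendrian : ∀ t ∈ Icc (-1 : ℝ) 1, deriv z t = p t * deriv q t
  single_cusp : ∃ c ∈ Ioo (-1 : ℝ) 1, deriv (deriv q) c ≠ 0 ∧
    ∀ t ∈ Icc (-1 : ℝ) 1, (deriv q t = 0 ∧ deriv z t = 0) ↔ t = c
  single_crossing : ∃ b ∈ Icc (-1 : ℝ) 1, ∃ b' ∈ Icc (-1 : ℝ) 1, b < b' ∧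
    deriv q b * deriv z b' - deriv q b' * deriv z b ≠ 0 ∧
    ∀ s ∈ Icc (-1 : ℝ) 1, ∀ t ∈ Icc (-1 : ℝ) 1, s < t →
      ((q s = q t ∧ z s = z t) ↔ (s = b ∧ t = b'))
  single_chord : ∃ b ∈ Icc (-1 : ℝ) 1, ∃ b' ∈ Icc (-1 : ℝ) 1, b < b' ∧ a = |z b' - z b| ∧
    ∀ s ∈ Icc (-1 : ℝ) 1, ∀ t ∈ Icc (-1 : ℝ) 1, s < t →
      ((p s = p t ∧ q s = q t) ↔ (s = b ∧ t = b'))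

/-- The arc `{(p t, q t, z t) | t ∈ [-1, 1]}`. -/
def arcImage (p q z : ℝ → ℝ) : Set (ℝ × ℝ × ℝ) := (fun t => (p t, q t, z t)) '' Icc (-1) 1

/-- The product `B × [-ρ, ρ]^m × [-ρ, ρ]^m`. -/
def looseBox {m : ℕ} (B : Set (ℝ × ℝ × ℝ)) (ρ : ℝ) : Set (LooseModel m) :=
  {u | u.1 ∈ B ∧ (∀ i, u.2.1 i ∈ Icc (-ρ) ρ) ∧ ∀ i, u.2.2 i ∈ Icc (-ρ) ρ}

/-! ### Submanifolds, Legendrian submanifolds, loose charts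

The contact manifolds below are (embedded) submanifolds `M` of a manifold `X`, possibly `M = X`,
whose contact hyperplanes are the intersections of the tangent spaces of `M` with given subspaces
`ξ x ⊆ T_x X`. -/

section Submanifolds

variable {E H X : Type*} [NormedAddCommGroup E] [NormedSpace ℝ E] [TopologicalSpace H]
  (I : ModelWithCorners ℝ E H) [TopologicalSpace X] [ChartedSpace H X]

/-- `σ` is a smooth parametrization by `ℝ^k` of a relatively open part of the `k`-dimensional
submanifold `L` of `X`: a smooth embedding whose image is an open subset of `L`. -/
structure IsLocalParam (k : ℕ) (L : Set X) (σ : EuclideanSpace ℝ (Fin k) → X) : Prop where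
  smooth : ContMDiff 𝓘(ℝ, EuclideanSpace ℝ (Fin k)) I ∞ σ
  embedding : IsEmbedding σ
  immersion : ∀ u, Function.Injective (mfderiv 𝓘(ℝ, EuclideanSpace ℝ (Fin k)) I σ u)
  range_open : ∃ W : Set X, IsOpen W ∧ range σ = W ∩ L

/-- `L` is a `k`-dimensional submanifold of `X` which is contained in `M` and tangent to `ξ`. For
`M` a contact submanifold of dimension `2 k + 1` with contact structure `ξ ∩ TM`, this says that `L`
is a Legendrian submanifold of `M`. -/
def IsLegendrian (M : Set X) (ξ : ∀ x : X, Submodule ℝ (TangentSpace I x)) (k : ℕ)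
    (L : Set X) : Prop :=
  L ⊆ M ∧ ∀ x ∈ L, ∃ σ : EuclideanSpace ℝ (Fin k) → X, IsLocalParam I k L σ ∧ x ∈ range σ ∧
    ∀ u w, mfderiv 𝓘(ℝ, EuclideanSpace ℝ (Fin k)) I σ u w ∈ ξ (σ u)

/-- `ψ` is a contact embedding of the open set `O` of the standard contact space
`ℝ³ × ℝ^m × ℝ^m` onto an open subset of the contact manifold `(M, ξ ∩ TM)` of
dimension `2 m + 3`. -/
structure IsContactParam (M : Set X) (ξ : ∀ x : X, Submodule ℝ (TangentSpace I x)) (m : ℕ)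
    (O : Set (LooseModel m)) (ψ : LooseModel m → X) : Prop where
  isOpen : IsOpen O
  smooth : ContMDiffOn 𝓘(ℝ, LooseModel m) I ∞ ψ O
  embedding : IsEmbedding (O.domRestrict ψ)
  immersion : ∀ u ∈ O, Function.Injective (mfderiv 𝓘(ℝ, LooseModel m) I ψ u)
  image_open : ∃ W : Set X, IsOpen W ∧ ψ '' O = W ∩ M
  contact : ∀ u ∈ O, ∀ w : LooseModel m,
    mfderiv 𝓘(ℝ, LooseModel m) I ψ u w ∈ ξ (ψ u) ↔ stdContactForm u w = 0

/-- `Λ` admits a loose chart in the complement of `A`, in the contact manifold `(M, ξ ∩ TM)` of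
dimension `2 m + 3`. The chart `U → ℝ³ × ℝ^m × ℝ^m` is given by its inverse `ψ`, defined near
`B × [-ρ, ρ]^m × [-ρ, ρ]^m`, so that `U` is the image of this set by `ψ`; it is required to map
`Λ ∩ U` onto `γ × {y = 0}`. For `m = 0` there is no quantitative condition. -/
def HasLooseChart (M : Set X) (ξ : ∀ x : X, Submodule ℝ (TangentSpace I x)) (m : ℕ)
    (Λ A : Set X) : Prop :=
  ∃ (B : Set (ℝ × ℝ × ℝ)) (p q z : ℝ → ℝ) (a ρ : ℝ) (O : Set (LooseModel m))
    (ψ : LooseModel m → X),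
    -- `B` is a convex closed ball containing the stabilization `γ` of action `a`
    (Convex ℝ B ∧ IsCompact B ∧ (interior B).Nonempty) ∧
    IsStabilization p q z a ∧ arcImage p q z ⊆ B ∧
    0 < ρ ∧ (1 ≤ m → a / ρ ^ 2 < 2) ∧
    IsContactParam I M ξ m O ψ ∧ looseBox B ρ ⊆ O ∧ Disjoint (ψ '' O) A ∧
    ∀ u ∈ looseBox B ρ, ψ u ∈ Λ ↔ (u.1 ∈ arcImage p q z ∧ u.2.2 = 0)

/-- Every connected component `Λ` of `L` admits a loose chart in the complement of `L \ Λ`. -/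
def ComponentsHaveLooseCharts (M : Set X) (ξ : ∀ x : X, Submodule ℝ (TangentSpace I x)) (m : ℕ)
    (L : Set X) : Prop :=
  ∀ x ∈ L, HasLooseChart I M ξ m (connectedComponentIn L x) (L \ connectedComponentIn L x)

/-- `L` is a loose Legendrian submanifold, of dimension `m + 1 ≥ 2`, of the contact manifold
`(M, ξ ∩ TM)` of dimension `2 m + 3`. -/
def IsLoose (M : Set X) (ξ : ∀ x : X, Submodule ℝ (TangentSpace I x)) (m : ℕ) (L : Set X) : Prop :=
  1 ≤ m ∧ IsLegendrian I M ξ (m + 1) L ∧ ComponentsHaveLooseCharts I M ξ m L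

/-- `L` is a stabilized Legendrian submanifold, of dimension `1`, of the `3`-dimensional contact
manifold `(M, ξ ∩ TM)`. -/
def IsStabilized (M : Set X) (ξ : ∀ x : X, Submodule ℝ (TangentSpace I x)) (L : Set X) : Prop :=
  IsLegendrian I M ξ 1 L ∧ ComponentsHaveLooseCharts I M ξ 0 L

/-- The submanifold `L` of `X` has dimension `k`, and the restriction of `f` to `L` is smooth with
differential the restriction of the `1`-form `η`. -/
def IsPrimitiveOn (η : ∀ x : X, TangentSpace I x →L[ℝ] ℝ) (k : ℕ) (L : Set X) (f : X → ℝ) : Prop :=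
  ∀ x ∈ L, ∃ σ : EuclideanSpace ℝ (Fin k) → X, IsLocalParam I k L σ ∧ x ∈ range σ ∧
    ContDiff ℝ ∞ (f ∘ σ) ∧
    ∀ u w, fderiv ℝ (f ∘ σ) u w = η (σ u) (mfderiv 𝓘(ℝ, EuclideanSpace ℝ (Fin k)) I σ u w)

/-- The `1`-form `lam + dt` on `X × ℝ`. -/
def contactizationForm (lam : ∀ x : X, TangentSpace I x →L[ℝ] ℝ) (c : X × ℝ) :
    TangentSpace (I.prod 𝓘(ℝ, ℝ)) c →L[ℝ] ℝ :=
  let dt : TangentSpace (I.prod 𝓘(ℝ, ℝ)) c →L[ℝ] ℝ :=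
    mfderiv (I.prod 𝓘(ℝ, ℝ)) 𝓘(ℝ, ℝ) (Prod.snd : X × ℝ → ℝ) c
  (lam c.1).comp (mfderiv (I.prod 𝓘(ℝ, ℝ)) I (Prod.fst : X × ℝ → X) c) + dt

/-- The contactization `S × ℝ` of the submanifold `S` of `X` with the restriction of a `1`-form; its
contact form is the restriction of `contactizationForm`. -/
def contactization (S : Set X) : Set (X × ℝ) := {c | c.1 ∈ S}

/-- The hyperplanes `ker (lam + dt)` on `X × ℝ`. -/
def contactizationPlane (lam : ∀ x : X, TangentSpace I x →L[ℝ] ℝ) (c : X × ℝ) :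
    Submodule ℝ (TangentSpace (I.prod 𝓘(ℝ, ℝ)) c) :=
  LinearMap.ker (contactizationForm I lam c).toLinearMap

/-- `C ⊆ S × ℝ` is a Legendrian lift of `L`, where `S` is a `2 k`-dimensional submanifold of `X` on
which the `1`-form `lam` has symplectic differential: `L` is a `k`-dimensional submanifold of `S` on
which `-lam` has a primitive (an exact Lagrangian submanifold of `S`), and `C` is the
graph over `L` of such a primitive. -/
def IsLegendrianLift (lam : ∀ x : X, TangentSpace I x →L[ℝ] ℝ) (S : Set X) (k : ℕ) (L : Set X)
    (C : Set (X × ℝ)) : Prop :=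
  L ⊆ S ∧ ∃ f : X → ℝ, IsPrimitiveOn I (fun x => -lam x) k L f ∧ C = {c | c.1 ∈ L ∧ c.2 = f c.1}

end Submanifolds

/-! ### Contact structures and symplectization -/

section Contact

variable {d : ℕ} {V : Type*} [TopologicalSpace V] [ChartedSpace (EuclideanSpace ℝ (Fin d)) V]

/-- The expression of the `1`-form `α` in the preferred chart at `x`. -/
def formInChart (α : ∀ x : V, TangentSpace (𝓡 d) x →L[ℝ] ℝ) (x : V)
    (y : EuclideanSpace ℝ (Fin d)) : EuclideanSpace ℝ (Fin d) →L[ℝ] ℝ :=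
  (α ((extChartAt (𝓡 d) x).symm y)).comp
    (mfderiv 𝓘(ℝ, EuclideanSpace ℝ (Fin d)) (𝓡 d) (extChartAt (𝓡 d) x).symm y)

/-- The exterior derivative of `α` at `x`, read in the preferred chart at `x`:
`dα(v, w) = ∂_v α(w) - ∂_w α(v)`. -/
def dFormInChart (α : ∀ x : V, TangentSpace (𝓡 d) x →L[ℝ] ℝ) (x : V)
    (v w : EuclideanSpace ℝ (Fin d)) : ℝ :=
  fderiv ℝ (formInChart α x) (extChartAt (𝓡 d) x x) v w -
    fderiv ℝ (formInChart α x) (extChartAt (𝓡 d) x x) w v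

/-- `α` satisfies the contact condition at `x`: it does not vanish at `x` and `dα` is nondegenerate
on `ker α` at `x`. -/
def IsContactFormAt (α : ∀ x : V, TangentSpace (𝓡 d) x →L[ℝ] ℝ) (x : V) : Prop :=
  α x ≠ 0 ∧ ∀ v, formInChart α x (extChartAt (𝓡 d) x x) v = 0 → v ≠ 0 →
    ∃ w, formInChart α x (extChartAt (𝓡 d) x x) w = 0 ∧ dFormInChart α x v w ≠ 0

/-- The total space of the cotangent bundle of `V`. -/
abbrev CotangentTotal (d : ℕ) (V : Type*) [TopologicalSpace V]
    [ChartedSpace (EuclideanSpace ℝ (Fin d)) V] : Type _ :=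
  TotalSpace (EuclideanSpace ℝ (Fin d) →L[ℝ] ℝ)
    (fun x : V => TangentSpace (𝓡 d) x →L[ℝ] ℝ)

/-- The model with corners (without boundary) of the cotangent bundle. -/
abbrev cotangentModel (d : ℕ) :=
  (𝓡 d).prod 𝓘(ℝ, EuclideanSpace ℝ (Fin d) →L[ℝ] ℝ)

variable [IsManifold (𝓡 d) ∞ V]

variable (d V) in
/-- A cooriented contact structure: a hyperplane field `plane` with, for each `x`, the set
`positive x` of the vectors on the positive side of `plane x`, which near each point are defined by
a smooth contact form `α`, as `ker α` and `{α > 0}`. -/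
structure CoorientedContactStructure where
  plane : ∀ x : V, Submodule ℝ (TangentSpace (𝓡 d) x)
  positive : ∀ x : V, Set (TangentSpace (𝓡 d) x)
  exists_form : ∀ x₀ : V, ∃ (U : Set V) (α : ∀ x : V, TangentSpace (𝓡 d) x →L[ℝ] ℝ),
    IsOpen U ∧ x₀ ∈ U ∧
    ContMDiffOn (𝓡 d) (cotangentModel d) ∞ (fun x => (⟨x, α x⟩ : CotangentTotal d V)) U ∧
    ∀ x ∈ U, IsContactFormAt α x ∧ ∀ v, (v ∈ plane x ↔ α x v = 0) ∧ (v ∈ positive x ↔ 0 < α x v)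

variable (d V) in
/-- The canonical (Liouville) `1`-form of the cotangent bundle: at the covector `θ` over `x`, it is
the pullback of `θ` by the differential of the projection. -/
def canonicalForm (c : CotangentTotal d V) : TangentSpace (cotangentModel d) c →L[ℝ] ℝ :=
  c.2.comp (mfderiv (cotangentModel d) (𝓡 d) (fun c : CotangentTotal d V => c.proj) c)

/-- The symplectization `SV` of `V`: the set of covectors which define the contact structure with
its coorientation. It is a submanifold of dimension `d + 1` of the cotangent bundle on which the
canonical `1`-form has symplectic differential. -/
def symplectization (ξ : CoorientedContactStructure d V) : Set (CotangentTotal d V) :=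
  {c | (∀ v, v ∈ ξ.plane c.proj ↔ c.2 v = 0) ∧ ∀ v, v ∈ ξ.positive c.proj ↔ 0 < c.2 v}

/-- The preimage `SΛ` of `Λ` under the projection `SV → V`. -/
def symplectizationLift (ξ : CoorientedContactStructure d V) (Λ : Set V) :
    Set (CotangentTotal d V) :=
  {c | c ∈ symplectization ξ ∧ c.proj ∈ Λ}

end Contact

end

/-! The canonical form at a covector `c` over `x` evaluates `c` on projected tangent vectors. A
vector tangent to `SΛ` projects into `ξ`, the kernel of `c`, so `λ` vanishes on `SΛ`
(`canonicalForm_mfderiv_eq_zero`). Hence `0` is a primitive, every primitive is locally constant,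
and a lift is Legendrian because `λ + dt` restricts to `λ + df = 0`. The fibres of `SV → V` are open
rays, so the components of the lift lie exactly over the components `Λ₀` of `Λ`, and over `Λ₀` the
lift is `SΛ₀ × {c}` (`connectedComponentIn_graph`).

It remains to turn a chart `ψ` for `Λ₀` into one for `SΛ₀ × {c}`. After shrinking, `ψ` preserves or
reverses coorientations throughout, with sign `ε`, and the covectors `b` with `ψ^* b = ε α`, where
`α` is the standard form, give a smooth section of `SV` along `ψ`
(`IsContactParam.exists_covector_lift`). With `r` the logarithm of the fibre scale, the contact form
of `CSV` becomes `ε e^r α + dt`. Substituting `r = -x₀/κ` and `t = c + εκ e^r y₀`, and replacing `z`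
by `z - κ y₀` in `α`, gives `ε e^r` times the standard form with one more pair `(x₀, y₀)`
(`stdContactForm_looseProj`). The locus `t = c` is `y₀ = 0`, where the shift of `z` disappears, so
the lift is again the same arc times `{y = 0}`.

The same `ρ` and action serve in the new chart: `x₀` is unrestricted because the fibre is a whole
line, and a small `κ` keeps the shift `κ y₀` inside the old domain. For curves the old box does not
depend on `ρ`, so `ρ` can first be made large. This is why stabilized curves lift to loose surfaces
(`exists_looseBox_subset`). -/

noncomputable section

/-! ### Positive rescaling in the fibres of a vector bundle -/

section FiberScale

open Filter

variable {B F : Type*} {E : B → Type*} [NormedAddCommGroup F] [TopologicalSpace B]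
  [TopologicalSpace (TotalSpace F E)] [∀ x, TopologicalSpace (E x)]

section FiberBundle

variable [FiberBundle F E]

theorem eventually_mem_baseSet {X : Type*} {l : Filter X} {f : X → TotalSpace F E}
    {c : TotalSpace F E} (hf : Tendsto f l (𝓝 c)) :
    ∀ᶠ x in l, (f x).proj ∈ (trivializationAt F E c.proj).baseSet :=
  (((FiberBundle.continuous_proj F E).tendsto c).comp hf)
    ((Trivialization.open_baseSet _).mem_nhds (mem_baseSet_trivializationAt F E c.proj))

theorem tendsto_trivializationAt_snd {X : Type*} {l : Filter X} {f : X → TotalSpace F E}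
    {c : TotalSpace F E} (hf : Tendsto f l (𝓝 c)) :
    Tendsto (fun x => (trivializationAt F E c.proj (f x)).2) l
      (𝓝 (trivializationAt F E c.proj c).2) :=
  (((trivializationAt F E c.proj).tendsto_nhds_iff
    FiberBundle.mem_trivializationAt_proj_source).1 hf).2

end FiberBundle

variable [NormedSpace ℝ F] [∀ x, AddCommGroup (E x)] [∀ x, Module ℝ (E x)]

/-- The vector `c` of a vector bundle, multiplied by `exp r`. -/
def fiberScale (c : TotalSpace F E) (r : ℝ) : TotalSpace F E := ⟨c.proj, Real.exp r • c.2⟩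

variable [FiberBundle F E] [VectorBundle ℝ F E]

theorem trivializationAt_fiberScale {b : B} {c : TotalSpace F E} (r : ℝ)
    (hc : c.proj ∈ (trivializationAt F E b).baseSet) :
    (trivializationAt F E b (fiberScale c r)).2 =
      Real.exp r • (trivializationAt F E b c).2 :=
  ((trivializationAt F E b).linear ℝ hc).map_smul (Real.exp r) c.2

theorem trivializationAt_snd_ne_zero {c : TotalSpace F E} (hc : c.2 ≠ 0) :
    (trivializationAt F E c.proj c).2 ≠ 0 := by
  intro h
  have hb := mem_baseSet_trivializationAt F E c.proj
  have h0 := ((trivializationAt F E c.proj).continuousLinearEquivAt ℝ c.proj hb).map_eq_zero_iff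
    (x := c.2)
  exact hc (h0.1 h)

/-- The parameter `x` is recovered from the base point. The scale is recovered continuously as a
quotient of values of a linear functional that does not vanish on `θ x`. -/
theorem isEmbedding_fiberScale {X : Type*} [TopologicalSpace X] {θ : X → TotalSpace F E}
    (hθ : Continuous θ) (hg : IsEmbedding fun x => (θ x).proj) (h0 : ∀ x, (θ x).2 ≠ 0)
    (hcont : Continuous fun p : X × ℝ => fiberScale (θ p.1) p.2) :
    IsEmbedding fun p : X × ℝ => fiberScale (θ p.1) p.2 := by
  -- An arbitrary filter is allowed so that the comap of a neighbourhood filter can be inserted,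
  -- which gives the inducing property.
  have key : ∀ (l : Filter (X × ℝ)) (p₀ : X × ℝ),
      Tendsto (fun p : X × ℝ => fiberScale (θ p.1) p.2) l (𝓝 (fiberScale (θ p₀.1) p₀.2)) →
      Tendsto id l (𝓝 p₀) := by
    intro l p₀ h
    have h1 : Tendsto (fun p : X × ℝ => p.1) l (𝓝 p₀.1) := by
      rw [hg.tendsto_nhds_iff]
      exact Tendsto.comp (f := fun p : X × ℝ => fiberScale (θ p.1) p.2)
        ((FiberBundle.continuous_proj F E).tendsto (fiberScale (θ p₀.1) p₀.2)) h
    have h2 : Tendsto (fun p : X × ℝ => θ p.1) l (𝓝 (θ p₀.1)) := (hθ.tendsto _).comp h1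
    have h3 := tendsto_trivializationAt_snd h2
    have h4 := tendsto_trivializationAt_snd h
    obtain ⟨φ, hφ⟩ := SeparatingDual.exists_ne_zero (R := ℝ) (trivializationAt_snd_ne_zero (h0 p₀.1))
    have h5 := (φ.continuous.tendsto _).comp h3
    have h6 := (φ.continuous.tendsto _).comp h4
    have h7 := h6.div h5 hφ
    have hb := mem_baseSet_trivializationAt F E (θ p₀.1).proj
    have h8 : Tendsto (fun p : X × ℝ => Real.exp p.2) l (𝓝 (Real.exp p₀.2)) := by
      have e0 : Real.exp p₀.2 = φ (trivializationAt F E (fiberScale (θ p₀.1) p₀.2).proj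
          (fiberScale (θ p₀.1) p₀.2)).2 / φ (trivializationAt F E (θ p₀.1).proj (θ p₀.1)).2 := by
        rw [show (fiberScale (θ p₀.1) p₀.2).proj = (θ p₀.1).proj from rfl,
          trivializationAt_fiberScale _ hb, map_smul, smul_eq_mul, mul_div_cancel_right₀ _ hφ]
      rw [e0]
      refine h7.congr' ?_
      have hne := h5.eventually_ne hφ
      filter_upwards [eventually_mem_baseSet h2, hne] with p hp hp'
      change φ (trivializationAt F E (θ p₀.1).proj (fiberScale (θ p.1) p.2)).2 / _ = _
      rw [trivializationAt_fiberScale _ hp, map_smul, smul_eq_mul]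
      exact mul_div_cancel_right₀ _ hp'
    have h9 : Tendsto (fun p : X × ℝ => p.2) l (𝓝 p₀.2) := by
      have := ((Real.continuousAt_log (Real.exp_ne_zero p₀.2)).tendsto).comp h8
      simpa [Function.comp_def] using this
    exact h1.prodMk_nhds h9
  refine ⟨isInducing_iff_nhds.2 fun p₀ => le_antisymm ?_ ?_, ?_⟩
  · exact (hcont.tendsto p₀).le_comap
  · exact key _ p₀ tendsto_comap
  · intro p p' h
    have hpp : p.1 = p'.1 := hg.injective (congrArg (TotalSpace.proj (F := F) (E := E)) h :)
    obtain ⟨x, r⟩ := p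
    obtain ⟨x', r'⟩ := p'
    obtain rfl : x = x' := hpp
    have h' : Real.exp r • (θ x).2 = Real.exp r' • (θ x).2 := by
      simpa [fiberScale] using h
    have := smul_left_injective ℝ (h0 x) h'
    rw [Real.exp_injective this]

variable {EB HB : Type*} [NormedAddCommGroup EB] [NormedSpace ℝ EB] [TopologicalSpace HB]
  {IB : ModelWithCorners ℝ EB HB} [ChartedSpace HB B]

theorem ContMDiffWithinAt.fiberScale {EM HM M : Type*} [NormedAddCommGroup EM] [NormedSpace ℝ EM]
    [TopologicalSpace HM] {IM : ModelWithCorners ℝ EM HM} [TopologicalSpace M] [ChartedSpace HM M]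
    {θ : M → TotalSpace F E} {ρ : M → ℝ} {s : Set M} {x : M} (hx : x ∈ s)
    (hθ : ContMDiffWithinAt IM (IB.prod 𝓘(ℝ, F)) ∞ θ s x)
    (hρ : ContMDiffWithinAt IM 𝓘(ℝ, ℝ) ∞ ρ s x) :
    ContMDiffWithinAt IM (IB.prod 𝓘(ℝ, F)) ∞ (fun y => fiberScale (θ y) (ρ y)) s x := by
  have h := contMDiffWithinAt_totalSpace.1 hθ
  refine contMDiffWithinAt_totalSpace.2 ⟨h.1, ?_⟩
  have he : ContMDiffWithinAt IM 𝓘(ℝ, ℝ) ∞ (fun y => Real.exp (ρ y)) s x :=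
    (Real.contDiff_exp.contMDiff.contMDiffAt).comp_contMDiffWithinAt x hρ
  refine (he.smul h.2).congr_of_eventuallyEq_of_mem ?_ hx
  filter_upwards [eventually_mem_baseSet hθ.continuousWithinAt] with y hy
  exact trivializationAt_fiberScale _ hy

/-- Projecting a kernel vector `(a, b)` to the base gives `a = 0`. In a trivialization the scale
direction then has derivative `b exp r` times the fibre vector, which is nonzero unless `b = 0`. -/
theorem injective_mfderiv_fiberScale {G : Type*} [NormedAddCommGroup G] [NormedSpace ℝ G]
    {θ : G → TotalSpace F E} {u : G} (r : ℝ)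
    (hθ : ContMDiffAt 𝓘(ℝ, G) (IB.prod 𝓘(ℝ, F)) ∞ θ u)
    (hg : Function.Injective (mfderiv 𝓘(ℝ, G) IB (fun x => (θ x).proj) u)) (h0 : (θ u).2 ≠ 0) :
    Function.Injective (mfderiv 𝓘(ℝ, G × ℝ) (IB.prod 𝓘(ℝ, F))
      (fun p : G × ℝ => fiberScale (θ p.1) p.2) (u, r)) := by
  set Θ : G × ℝ → TotalSpace F E := fun p => fiberScale (θ p.1) p.2 with hΘ
  have hfst : ContMDiffAt 𝓘(ℝ, G × ℝ) 𝓘(ℝ, G) ∞ (Prod.fst : G × ℝ → G) (u, r) :=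
    contDiff_fst.contMDiff.contMDiffAt
  have hΘs : ContMDiffAt 𝓘(ℝ, G × ℝ) (IB.prod 𝓘(ℝ, F)) ∞ Θ (u, r) := by
    have h1 : ContMDiffAt 𝓘(ℝ, G × ℝ) (IB.prod 𝓘(ℝ, F)) ∞ (fun p : G × ℝ => θ p.1) (u, r) :=
      ContMDiffAt.comp (u, r) (g := θ) hθ hfst
    exact ContMDiffWithinAt.fiberScale (mem_univ _) h1 contDiff_snd.contMDiff.contMDiffAt
  have hΘd : MDifferentiableAt 𝓘(ℝ, G × ℝ) (IB.prod 𝓘(ℝ, F)) Θ (u, r) :=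
    hΘs.mdifferentiableAt (by simp)
  -- Differentiability of the identity of the total space, split into components, gives that of the
  -- projection and of the local fibre coordinate.
  have hid : MDifferentiableAt (IB.prod 𝓘(ℝ, F)) (IB.prod 𝓘(ℝ, F))
      (id : TotalSpace F E → TotalSpace F E) (Θ (u, r)) := mdifferentiableAt_id
  have hid' := (mdifferentiableAt_totalSpace IB _).1 hid
  rw [injective_iff_map_eq_zero]
  rintro ⟨a, b⟩ hab
  have e1 : mfderiv 𝓘(ℝ, G × ℝ) IB (fun p : G × ℝ => (θ p.1).proj) (u, r) (a, b) = 0 :=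
    (mfderiv_comp_apply (u, r) hid'.1 hΘd (a, b)).trans
      ((congrArg _ hab).trans (map_zero _))
  have hgd : MDifferentiableAt 𝓘(ℝ, G) IB (fun x => (θ x).proj) u :=
    (contMDiffAt_totalSpace.1 hθ).1.mdifferentiableAt (by simp)
  have ha : a = 0 := by
    have h5 : mfderiv 𝓘(ℝ, G × ℝ) 𝓘(ℝ, G) (Prod.fst : G × ℝ → G) (u, r) (a, b) = a := by
      rw [mfderiv_eq_fderiv, fderiv_fst]; rfl
    refine (injective_iff_map_eq_zero _).1 hg a (Eq.trans ?_ e1)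
    exact ((mfderiv_comp_apply (I := 𝓘(ℝ, G × ℝ)) (I' := 𝓘(ℝ, G)) (I'' := IB) (u, r)
      (g := fun x => (θ x).proj) (f := (Prod.fst : G × ℝ → G)) hgd
      (hfst.mdifferentiableAt (by simp)) (a, b)).trans (congrArg _ h5)).symm
  subst ha
  obtain ⟨φ, hφ⟩ := SeparatingDual.exists_ne_zero (R := ℝ) (trivializationAt_snd_ne_zero h0)
  set N : TotalSpace F E → ℝ := fun c => φ (trivializationAt F E (θ u).proj c).2 with hN
  have hNd : MDifferentiableAt (IB.prod 𝓘(ℝ, F)) 𝓘(ℝ, ℝ) N (Θ (u, r)) :=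
    (φ.differentiableAt.mdifferentiableAt).comp _ hid'.2
  have h8 : mfderiv 𝓘(ℝ, G × ℝ) 𝓘(ℝ, ℝ) (N ∘ Θ) (u, r) ((0 : G), b) = 0 :=
    (mfderiv_comp_apply (u, r) hNd hΘd ((0 : G), b)).trans
      ((congrArg _ hab).trans (map_zero _))
  have hd : DifferentiableAt ℝ (N ∘ Θ) (u, r) := (hNd.comp _ hΘd).differentiableAt
  have h9 : HasDerivAt (fun t => (N ∘ Θ) (u, t)) (fderiv ℝ (N ∘ Θ) (u, r) (0, 1)) r :=
    hd.hasFDerivAt.comp_hasDerivAt r ((hasDerivAt_const r u).prodMk (hasDerivAt_id r))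
  have h10 : HasDerivAt (fun t => (N ∘ Θ) (u, t)) (Real.exp r * N (θ u)) r := by
    have : (fun t => (N ∘ Θ) (u, t)) = fun t => Real.exp t * N (θ u) := by
      ext t
      simp only [hN, hΘ, Function.comp]
      rw [trivializationAt_fiberScale _ (mem_baseSet_trivializationAt F E _), map_smul, smul_eq_mul]
    rw [this]
    exact (Real.hasDerivAt_exp r).mul_const _
  have h11 := h9.unique h10
  have h12 : fderiv ℝ (N ∘ Θ) (u, r) (0, b) = b * (Real.exp r * N (θ u)) := by
    rw [← h11, ← smul_eq_mul, ← map_smul]; simp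
  rw [mfderiv_eq_fderiv] at h8
  have h13 : b * (Real.exp r * N (θ u)) = 0 := by rw [← h12]; exact h8
  have : b = 0 := by
    rcases mul_eq_zero.1 h13 with h | h
    · exact h
    · exact absurd h (mul_ne_zero (Real.exp_ne_zero r) hφ)
  rw [this]; rfl

end FiberScale

/-! ### Tangency of smooth maps into a Legendrian submanifold -/

section Tangency

open Filter

/-- Here `η` plays the role of a smooth map read through the inverse of a parametrization `f`. It is
only known to be continuous, so the chain rule is unavailable. Injectivity of `L` bounds the
increments of `η`; then `h' w` is a limit of elements of the range of `L`, which is closed by finite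
dimensionality. -/
theorem HasFDerivAt.mem_range_of_eventuallyEq_comp {G K F : Type*} [NormedAddCommGroup G]
    [NormedSpace ℝ G] [NormedAddCommGroup K] [NormedSpace ℝ K] [FiniteDimensional ℝ K]
    [NormedAddCommGroup F] [NormedSpace ℝ F] {f : K → F} {h : G → F} {η : G → K} {u : G}
    {L : K →L[ℝ] F} {h' : G →L[ℝ] F} (hf : HasFDerivAt f L (η u)) (hh : HasFDerivAt h h' u)
    (hL : Function.Injective L) (hη : ContinuousAt η u) (hcomp : h =ᶠ[𝓝 u] f ∘ η) (w : G) :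
    ∃ v, L v = h' w := by
  obtain ⟨C, hC, hLC⟩ := L.toLinearMap.exists_antilipschitzWith (LinearMap.ker_eq_bot.2 hL)
  have h1 : (fun y => f (η y) - f (η u) - L (η y - η u)) =o[𝓝 u] fun y => η y - η u :=
    hf.isLittleO.comp_tendsto hη
  have h2 : (fun y => h y - h u) =O[𝓝 u] fun y => y - u := hh.isBigO_sub
  have h2' : (fun y => f (η y) - f (η u)) =O[𝓝 u] fun y => y - u := by
    refine h2.congr' ?_ EventuallyEq.rfl
    filter_upwards [hcomp] with y hy
    rw [hy, hcomp.self_of_nhds]; rfl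
  have h3 : (fun y => η y - η u) =O[𝓝 u] fun y => L (η y - η u) := by
    refine Asymptotics.IsBigO.of_bound C (Eventually.of_forall fun y => ?_)
    have := hLC.le_mul_dist (η y - η u) 0
    simpa [dist_eq_norm] using this
  -- The increment of `f ∘ η` differs from `L (η y - η u)` by a small fraction of the latter, so it
  -- controls it; and it equals the increment of `h`, which is `O(y - u)`.
  have h4 : (fun y => L (η y - η u)) =O[𝓝 u] fun y => y - u := by
    have h5 : (fun y => f (η y) - f (η u) - L (η y - η u)) =o[𝓝 u]
        fun y => L (η y - η u) := h1.trans_isBigO h3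
    have h6 := h5.right_isBigO_add
    have h7 : (fun y => L (η y - η u)) =O[𝓝 u] fun y => f (η y) - f (η u) := by
      refine h6.trans (Asymptotics.IsBigO.of_bound 1 (Eventually.of_forall fun y => ?_))
      simp
    exact h7.trans h2'
  have h8 : (fun y => f (η y) - f (η u) - L (η y - η u)) =o[𝓝 u] fun y => y - u :=
    h1.trans_isBigO (h3.trans h4)
  have h9 : (fun y => h' (y - u) - L (η y - η u)) =o[𝓝 u] fun y => y - u := by
    refine (h8.sub hh.isLittleO).congr' ?_ EventuallyEq.rfl
    filter_upwards [hcomp] with y hy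
    rw [hy, hcomp.self_of_nhds]
    simp only [Function.comp]
    abel
  have hclosed : IsClosed (LinearMap.range L.toLinearMap : Set F) :=
    Submodule.closed_of_finiteDimensional _
  suffices h' w ∈ (LinearMap.range L.toLinearMap : Set F) by simpa using this
  rw [← hclosed.closure_eq, Metric.mem_closure_iff]
  intro ε hε
  have hpath : Tendsto (fun t : ℝ => u + t • w) (𝓝[>] 0) (𝓝 u) := by
    have : Tendsto (fun t : ℝ => u + t • w) (𝓝 0) (𝓝 (u + (0 : ℝ) • w)) :=
      Continuous.tendsto (by fun_prop) 0
    rw [zero_smul, add_zero] at this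
    exact this.mono_left nhdsWithin_le_nhds
  have h10 := (h9.comp_tendsto hpath).def (c := ε / (‖w‖ + 1)) (by positivity)
  obtain ⟨t, ht, ht0⟩ := (h10.and self_mem_nhdsWithin).exists
  have ht0 : 0 < t := ht0
  simp only [Function.comp, add_sub_cancel_left, map_smul] at ht
  refine ⟨L (t⁻¹ • (η (u + t • w) - η u)), ⟨_, rfl⟩, ?_⟩
  rw [dist_eq_norm, map_smul]
  have e : h' w - t⁻¹ • L (η (u + t • w) - η u) =
      t⁻¹ • (t • h' w - L (η (u + t • w) - η u)) := by
    rw [smul_sub, smul_smul, inv_mul_cancel₀ ht0.ne', one_smul]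
  rw [e, norm_smul, norm_inv, Real.norm_of_nonneg ht0.le]
  rw [norm_smul, Real.norm_of_nonneg ht0.le] at ht
  calc t⁻¹ * _ ≤ t⁻¹ * (ε / (‖w‖ + 1) * (t * ‖w‖)) := by gcongr
    _ = ε * (‖w‖ / (‖w‖ + 1)) := by field_simp
    _ < ε * 1 := by
      gcongr
      rw [div_lt_one (by positivity)]; linarith
    _ = ε := mul_one ε

variable {d : ℕ} {V : Type*} [TopologicalSpace V] [ChartedSpace (EuclideanSpace ℝ (Fin d)) V]
  [IsManifold (𝓡 d) ∞ V]

/-- A smooth map with values in a Legendrian submanifold is tangent to the contact structure. -/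
theorem IsLegendrian.mfderiv_mem {M : Set V} {ξ : ∀ x : V, Submodule ℝ (TangentSpace (𝓡 d) x)}
    {k : ℕ} {L : Set V} (hL : IsLegendrian (𝓡 d) M ξ k L) {G : Type*} [NormedAddCommGroup G]
    [NormedSpace ℝ G] {g : G → V} {u : G} (hg : MDifferentiableAt 𝓘(ℝ, G) (𝓡 d) g u)
    (hgL : ∀ y, g y ∈ L) (w : G) : mfderiv 𝓘(ℝ, G) (𝓡 d) g u w ∈ ξ (g u) := by
  obtain ⟨σ, hσ, ⟨v₀, hv₀⟩, htan⟩ := hL.2 (g u) (hgL u)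
  obtain ⟨W, hWo, hW⟩ := hσ.range_open
  have hdσ : MDifferentiableAt 𝓘(ℝ, EuclideanSpace ℝ (Fin k)) (𝓡 d) σ v₀ :=
    (hσ.smooth v₀).mdifferentiableAt (by simp)
  have : Nonempty (EuclideanSpace ℝ (Fin k)) := ⟨0⟩
  set η : G → EuclideanSpace ℝ (Fin k) := fun y => Function.invFun σ (g y) with hη
  have hηu : η u = v₀ := by
    rw [hη]; simp only [← hv₀]; exact Function.leftInverse_invFun hσ.embedding.injective v₀
  have hev : ∀ᶠ y in 𝓝 u, σ (η y) = g y := by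
    have huW : g u ∈ W := (hW ▸ (⟨v₀, hv₀⟩ : g u ∈ range σ) : g u ∈ W ∩ L).1
    filter_upwards [hg.continuousAt (hWo.mem_nhds huW)] with y hy
    have : g y ∈ range σ := hW ▸ ⟨hy, hgL y⟩
    exact Function.invFun_eq this
  have hcont : ContinuousAt η u := by
    rw [ContinuousAt, hσ.embedding.tendsto_nhds_iff, hηu, hv₀]
    exact hg.continuousAt.congr' (hev.mono fun y hy => hy.symm)
  -- The preceding lemma concerns normed spaces, so both maps are composed with the chart at `g u`,
  -- whose differential is injective.
  have hκ : MDifferentiableAt (𝓡 d) 𝓘(ℝ, EuclideanSpace ℝ (Fin d)) (extChartAt (𝓡 d) (g u)) (g u) :=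
    mdifferentiableAt_extChartAt (mem_chart_source _ _)
  have hκσ : MDifferentiableAt (𝓡 d) 𝓘(ℝ, EuclideanSpace ℝ (Fin d)) (extChartAt (𝓡 d) (g u)) (σ v₀) := by
    rw [hv₀]; exact hκ
  have hinj : Function.Injective (mfderiv (𝓡 d) 𝓘(ℝ, EuclideanSpace ℝ (Fin d))
      (extChartAt (𝓡 d) (g u)) (g u)) :=
    (isInvertible_mfderiv_extChartAt (mem_extChartAt_source (g u))).injective
  have hinjσ : Function.Injective (mfderiv (𝓡 d) 𝓘(ℝ, EuclideanSpace ℝ (Fin d))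
      (extChartAt (𝓡 d) (g u)) (σ v₀)) := by
    have : ∀ x, x = g u → Function.Injective (mfderiv (𝓡 d) 𝓘(ℝ, EuclideanSpace ℝ (Fin d))
      (extChartAt (𝓡 d) (g u)) x) := by rintro x rfl; exact hinj
    exact this _ hv₀
  have d1 : HasFDerivAt (extChartAt (𝓡 d) (g u) ∘ σ) _ v₀ :=
    ((hκσ.comp v₀ hdσ).hasMFDerivAt).hasFDerivAt
  have d2 : HasFDerivAt (extChartAt (𝓡 d) (g u) ∘ g) _ u :=
    ((hκ.comp u hg).hasMFDerivAt).hasFDerivAt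
  rw [mfderiv_comp v₀ hκσ hdσ] at d1
  rw [mfderiv_comp u hκ hg] at d2
  obtain ⟨L₁, hL₁⟩ : ∃ L₁ : EuclideanSpace ℝ (Fin k) →L[ℝ] EuclideanSpace ℝ (Fin d),
      L₁ = (mfderiv (𝓡 d) 𝓘(ℝ, EuclideanSpace ℝ (Fin d)) (extChartAt (𝓡 d) (g u)) (σ v₀)).comp
        (mfderiv 𝓘(ℝ, EuclideanSpace ℝ (Fin k)) (𝓡 d) σ v₀) := ⟨_, rfl⟩
  have hLinj : Function.Injective L₁ := hL₁ ▸ hinjσ.comp (hσ.immersion v₀)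
  have d1' : HasFDerivAt (extChartAt (𝓡 d) (g u) ∘ σ) L₁ (η u) := by
    rw [hηu, hL₁]; exact d1
  obtain ⟨v, hv⟩ := HasFDerivAt.mem_range_of_eventuallyEq_comp d1' d2 hLinj hcont (by
      filter_upwards [hev] with y hy
      simp only [Function.comp]; rw [hy]) w
  subst hL₁
  -- The base point is generalized because the tangent spaces at `g u` and `σ v₀` are identified
  -- only through the equality `hv₀`.
  have hfin : ∀ (x : V) (hx : x = σ v₀) (t : EuclideanSpace ℝ (Fin d)),
      (mfderiv (𝓡 d) 𝓘(ℝ, EuclideanSpace ℝ (Fin d)) (extChartAt (𝓡 d) (g u)) (σ v₀)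
        (mfderiv 𝓘(ℝ, EuclideanSpace ℝ (Fin k)) (𝓡 d) σ v₀ v) : EuclideanSpace ℝ (Fin d)) =
      (mfderiv (𝓡 d) 𝓘(ℝ, EuclideanSpace ℝ (Fin d)) (extChartAt (𝓡 d) (g u)) x t) →
      (show TangentSpace (𝓡 d) x from t) ∈ ξ x := by
    rintro x rfl t ht
    rw [← hinjσ ht]
    exact htan v₀ v
  exact hfin (g u) hv₀.symm _ hv

end Tangency

/-! ### Fibres of the symplectization and components of the lift -/

section Symplectization

open Filter

variable {d : ℕ} {V : Type*} [TopologicalSpace V] [ChartedSpace (EuclideanSpace ℝ (Fin d)) V]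
  [IsManifold (𝓡 d) ∞ V]

/-- Equal kernels force proportionality, and equal positive sides force a positive factor. Thus each
fibre of `SV` is a single orbit of `fiberScale`. -/
theorem exists_exp_smul_eq_of_forall_iff {G : Type*} [TopologicalSpace G] [AddCommGroup G]
    [Module ℝ G] {a b : G →L[ℝ] ℝ} (ha : a ≠ 0) (h0 : ∀ v, a v = 0 ↔ b v = 0)
    (hpos : ∀ v, 0 < a v ↔ 0 < b v) : ∃ r : ℝ, b = Real.exp r • a := by
  obtain ⟨v, hv⟩ : ∃ v, a v ≠ 0 := by
    by_contra! h
    exact ha (ContinuousLinearMap.ext h)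
  obtain ⟨v, hv⟩ : ∃ v, 0 < a v := by
    rcases lt_or_gt_of_ne hv with h | h
    · exact ⟨-v, by simpa using h⟩
    · exact ⟨v, h⟩
  have hbv := (hpos v).1 hv
  refine ⟨Real.log (b v / a v), ?_⟩
  ext w
  have hw : b (w - (a w / a v) • v) = 0 := by
    rw [← h0, map_sub, map_smul, smul_eq_mul, div_mul_cancel₀ _ hv.ne', sub_self]
  rw [map_sub, map_smul, smul_eq_mul, sub_eq_zero] at hw
  rw [smul_apply, Real.exp_log (by positivity), hw, smul_eq_mul]
  field_simp

theorem CoorientedContactStructure.exists_section (ξ : CoorientedContactStructure d V) (x₀ : V) :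
    ∃ (U : Set V) (α : ∀ x : V, TangentSpace (𝓡 d) x →L[ℝ] ℝ), IsOpen U ∧ x₀ ∈ U ∧
      ContMDiffOn (𝓡 d) (cotangentModel d) ∞ (fun x => (⟨x, α x⟩ : CotangentTotal d V)) U ∧
      ∀ x ∈ U, α x ≠ 0 ∧ (⟨x, α x⟩ : CotangentTotal d V) ∈ symplectization ξ := by
  obtain ⟨U, α, hU, hx, hα, h⟩ := ξ.exists_form x₀
  exact ⟨U, α, hU, hx, hα, fun x hx => ⟨(h x hx).1.1, fun v => ((h x hx).2 v).1,
    fun v => ((h x hx).2 v).2⟩⟩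

theorem exists_mem_symplectization (ξ : CoorientedContactStructure d V) (x : V) :
    ∃ c ∈ symplectization ξ, c.proj = x := by
  obtain ⟨U, α, -, hx, -, h⟩ := ξ.exists_section x
  exact ⟨_, (h x hx).2, rfl⟩

theorem snd_ne_zero_of_mem_symplectization {ξ : CoorientedContactStructure d V}
    {c : CotangentTotal d V} (hc : c ∈ symplectization ξ) : c.2 ≠ 0 := by
  obtain ⟨U, α, -, hx, -, h⟩ := ξ.exists_section c.proj
  intro h0
  refine (h _ hx).1 (ContinuousLinearMap.ext fun v => ?_)
  have h1 : v ∈ ξ.plane c.proj := (hc.1 v).2 (by rw [h0]; rfl)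
  exact ((h _ hx).2.1 v).1 h1

theorem fiberScale_mem_symplectization {ξ : CoorientedContactStructure d V}
    {c : CotangentTotal d V} (hc : c ∈ symplectization ξ) (r : ℝ) :
    fiberScale c r ∈ symplectization ξ := by
  refine ⟨fun v => (hc.1 v).trans ?_, fun v => (hc.2 v).trans ?_⟩
  · change _ ↔ Real.exp r * c.2 v = 0
    simp [Real.exp_ne_zero]
  · change _ ↔ 0 < Real.exp r * c.2 v
    rw [mul_pos_iff_of_pos_left (Real.exp_pos r)]

theorem exists_eq_fiberScale {ξ : CoorientedContactStructure d V}
    {c c' : CotangentTotal d V} (hc : c ∈ symplectization ξ) (hc' : c' ∈ symplectization ξ)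
    (h : c'.proj = c.proj) : ∃ r, c' = fiberScale c r := by
  obtain ⟨x, a⟩ := c
  obtain ⟨x', b⟩ := c'
  obtain rfl : x' = x := h
  obtain ⟨r, hr⟩ := exists_exp_smul_eq_of_forall_iff (snd_ne_zero_of_mem_symplectization hc)
    (fun v => (hc.1 v).symm.trans (hc'.1 v)) (fun v => (hc.2 v).symm.trans (hc'.2 v))
  exact ⟨r, by rw [fiberScale]; exact congrArg _ hr⟩

theorem continuous_fiberScale (c : CotangentTotal d V) :
    Continuous fun r : ℝ => fiberScale c r := by
  have : ContMDiff 𝓘(ℝ, ℝ) (cotangentModel d) ∞ fun r : ℝ => fiberScale c r := fun r =>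
    ContMDiffWithinAt.fiberScale (mem_univ _) contMDiffAt_const contMDiffAt_id
  exact this.continuous

/-- A continuous two-valued function on the lift is constant on each ray, hence descends to `T`,
where it is continuous because `SV` has continuous local sections. -/
theorem isPreconnected_symplectizationLift (ξ : CoorientedContactStructure d V) {T : Set V}
    (hT : IsPreconnected T) : IsPreconnected (symplectizationLift ξ T) := by
  -- The section `τ` is a bare choice with no continuity. Constancy on fibres later lets it be
  -- replaced by a local contact form.
  choose τ hτ hτp using exists_mem_symplectization ξ
  refine isPreconnected_of_forall_constant fun f hf => ?_
  have hfib : ∀ c ∈ symplectizationLift ξ T, ∀ c' ∈ symplectizationLift ξ T,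
      c'.proj = c.proj → f c' = f c := by
    intro c hc c' hc' h
    obtain ⟨r, rfl⟩ := exists_eq_fiberScale hc.1 hc'.1 h
    have h1 : ContinuousOn (fun t : ℝ => f (fiberScale c t)) univ :=
      hf.comp (continuous_fiberScale c).continuousOn
        fun t _ => ⟨fiberScale_mem_symplectization hc.1 t, hc.2⟩
    have h2 := isPreconnected_univ.constant h1 (mem_univ r) (mem_univ 0)
    simpa [fiberScale] using h2
  have hτT : ∀ x ∈ T, τ x ∈ symplectizationLift ξ T := fun x hx =>
    ⟨hτ x, by rw [hτp]; exact hx⟩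
  have hF : ContinuousOn (fun x => f (τ x)) T := by
    intro x hx
    obtain ⟨U, α, hU, hxU, hα, h⟩ := ξ.exists_section x
    have hm : MapsTo (fun y => (⟨y, α y⟩ : CotangentTotal d V)) (T ∩ U)
      (symplectizationLift ξ T) := fun y hy => ⟨(h y hy.2).2, hy.1⟩
    have h1 : ContinuousWithinAt (fun y => f (⟨y, α y⟩ : CotangentTotal d V)) (T ∩ U) x :=
      (hf.comp (hα.continuousOn.mono inter_subset_right) hm) x ⟨hx, hxU⟩
    rw [← continuousWithinAt_inter (hU.mem_nhds hxU)]
    refine h1.congr (fun y hy => ?_) ?_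
    · exact hfib _ (hm hy) _ (hτT y hy.1) (hτp y)
    · exact hfib _ (hm ⟨hx, hxU⟩) _ (hτT x hx) (hτp x)
  intro c hc c' hc'
  have h1 := hfib _ (hτT _ hc.2) c hc (hτp _).symm
  have h2 := hfib _ (hτT _ hc'.2) c' hc' (hτp _).symm
  rw [h1, h2]
  exact hT.constant hF hc.2 hc'.2

theorem canonicalForm_mfderiv {G : Type*} [NormedAddCommGroup G] [NormedSpace ℝ G]
    {σ : G → CotangentTotal d V} {u : G}
    (hσ : MDifferentiableAt 𝓘(ℝ, G) (cotangentModel d) σ u) (w : G) :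
    canonicalForm d V (σ u) (mfderiv 𝓘(ℝ, G) (cotangentModel d) σ u w) =
      (σ u).2 (mfderiv 𝓘(ℝ, G) (𝓡 d) (fun y => (σ y).proj) u w) := by
  have hp : MDifferentiableAt (cotangentModel d) (𝓡 d)
      (fun c : CotangentTotal d V => c.proj) (σ u) :=
    (contMDiffAt_proj (n := 1) _).mdifferentiableAt (by simp)
  exact congrArg _ (mfderiv_comp_apply u hp hσ w).symm

/-- The projected vector is tangent to `Λ`, hence lies in the contact plane, which is the kernel of
the covector. -/
theorem canonicalForm_mfderiv_eq_zero {ξ : CoorientedContactStructure d V} {M : Set V} {k : ℕ}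
    {Λ : Set V} (hΛ : IsLegendrian (𝓡 d) M ξ.plane k Λ) {G : Type*} [NormedAddCommGroup G]
    [NormedSpace ℝ G] {σ : G → CotangentTotal d V} {u : G}
    (hσ : MDifferentiableAt 𝓘(ℝ, G) (cotangentModel d) σ u)
    (hσΛ : ∀ y, σ y ∈ symplectizationLift ξ Λ) (w : G) :
    canonicalForm d V (σ u) (mfderiv 𝓘(ℝ, G) (cotangentModel d) σ u w) = 0 := by
  rw [canonicalForm_mfderiv hσ]
  refine ((hσΛ u).1.1 _).1 ?_
  have hp : MDifferentiableAt (cotangentModel d) (𝓡 d)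
      (fun c : CotangentTotal d V => c.proj) (σ u) :=
    (contMDiffAt_proj (n := 1) _).mdifferentiableAt (by simp)
  exact hΛ.mfderiv_mem (hp.comp u hσ) (fun y => (hσΛ y).2) w

/-- Along a parametrization the differential of `f` is `-λ = 0`, and the parameter domain is all of
Euclidean space, hence connected. -/
theorem IsPrimitiveOn.eventually_eq {ξ : CoorientedContactStructure d V} {M : Set V} {j k : ℕ}
    {Λ : Set V} (hΛ : IsLegendrian (𝓡 d) M ξ.plane j Λ) {f : CotangentTotal d V → ℝ}
    (hf : IsPrimitiveOn (cotangentModel d) (fun c => -canonicalForm d V c) k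
      (symplectizationLift ξ Λ) f) {c : CotangentTotal d V} (hc : c ∈ symplectizationLift ξ Λ) :
    ∀ᶠ c' in 𝓝[symplectizationLift ξ Λ] c, f c' = f c := by
  obtain ⟨σ, hσ, hcσ, hfs, hd⟩ := hf c hc
  obtain ⟨W, hW, hWr⟩ := hσ.range_open
  have hmem : ∀ y, σ y ∈ symplectizationLift ξ Λ := fun y =>
    ((hWr ▸ mem_range_self y : σ y ∈ W ∩ _)).2
  have hconst : ∀ y y', (f ∘ σ) y = (f ∘ σ) y' :=
    is_const_of_fderiv_eq_zero (hfs.differentiable (by simp)) fun u => by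
      ext1 w
      rw [hd]
      change -(canonicalForm d V (σ u) _) = 0
      rw [canonicalForm_mfderiv_eq_zero hΛ ((hσ.smooth u).mdifferentiableAt (by simp)) hmem,
        neg_zero]
  obtain ⟨u, rfl⟩ := hcσ
  have : W ∩ symplectizationLift ξ Λ ∈ 𝓝[symplectizationLift ξ Λ] (σ u) :=
    inter_mem (mem_nhdsWithin_of_mem_nhds (hW.mem_nhds
      (hWr ▸ mem_range_self u : σ u ∈ W ∩ _).1)) self_mem_nhdsWithin
  filter_upwards [this] with c' hc'
  rw [← hWr] at hc'
  obtain ⟨u', rfl⟩ := hc'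
  exact hconst u' u

theorem IsPreconnected.eq_of_eventually_eq {X Y : Type*} [TopologicalSpace X] {f : X → Y}
    {S T : Set X} (hT : IsPreconnected T) (hTS : T ⊆ S)
    (hf : ∀ x ∈ S, ∀ᶠ y in 𝓝[S] x, f y = f x) {x y : X} (hx : x ∈ T) (hy : y ∈ T) :
    f x = f y :=
  hT.induction₂ (fun x y => f x = f y)
    (fun x hx => ((hf x (hTS hx)).filter_mono (nhdsWithin_mono x hTS)).mono fun _ h => h.symm)
    (fun _ _ _ _ _ _ h h' => h.trans h') (fun _ _ _ _ h => h.symm) hx hy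

/-- The components of the lift of `Λ` to the contactization of the symplectization are the
preimages of the components of `Λ`. -/
theorem connectedComponentIn_graph (ξ : CoorientedContactStructure d V) {Λ : Set V}
    {f : CotangentTotal d V → ℝ}
    (hf : ∀ c ∈ symplectizationLift ξ Λ, ∀ᶠ c' in 𝓝[symplectizationLift ξ Λ] c, f c' = f c)
    {C : Set (CotangentTotal d V × ℝ)}
    (hC : C = {c | c.1 ∈ symplectizationLift ξ Λ ∧ c.2 = f c.1}) {c₀ : CotangentTotal d V × ℝ}
    (hc₀ : c₀ ∈ C) :
    connectedComponentIn C c₀ = {c | c ∈ C ∧ c.1.proj ∈ connectedComponentIn Λ c₀.1.proj} := by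
  have hproj : Continuous fun c : CotangentTotal d V × ℝ => c.1.proj :=
    (FiberBundle.continuous_proj _ _).comp continuous_fst
  have hCΛ : ∀ c ∈ C, c.1.proj ∈ Λ := by
    intro c hc; rw [hC] at hc; exact hc.1.2
  have hcontf : ContinuousOn f (symplectizationLift ξ Λ) := fun c hc =>
    tendsto_const_nhds.congr' ((hf c hc).mono fun _ h => h.symm)
  apply Subset.antisymm
  · intro c hc
    have hcC := connectedComponentIn_subset C c₀ hc
    refine ⟨hcC, ?_⟩
    have h1 : (fun c : CotangentTotal d V × ℝ => c.1.proj) '' connectedComponentIn C c₀ ⊆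
        connectedComponentIn Λ c₀.1.proj := by
      refine IsPreconnected.subset_connectedComponentIn
        (isPreconnected_connectedComponentIn.image _ hproj.continuousOn)
        ⟨c₀, mem_connectedComponentIn hc₀, rfl⟩ ?_
      rintro _ ⟨c', hc', rfl⟩
      exact hCΛ _ (connectedComponentIn_subset C c₀ hc')
    exact h1 ⟨c, hc, rfl⟩
  · have hsub : connectedComponentIn Λ c₀.1.proj ⊆ Λ := connectedComponentIn_subset _ _
    -- The candidate component is the image of a preconnected lift under the graph map, which is
    -- continuous since `f` is locally constant.
    have h2 : {c | c ∈ C ∧ c.1.proj ∈ connectedComponentIn Λ c₀.1.proj} =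
        (fun c => (c, f c)) '' symplectizationLift ξ (connectedComponentIn Λ c₀.1.proj) := by
      ext c
      constructor
      · rintro ⟨hc, hcp⟩
        rw [hC] at hc
        exact ⟨c.1, ⟨hc.1.1, hcp⟩, Prod.ext rfl hc.2.symm⟩
      · rintro ⟨c, hc, rfl⟩
        rw [hC]
        exact ⟨⟨⟨hc.1, hsub hc.2⟩, rfl⟩, hc.2⟩
    rw [h2]
    refine IsPreconnected.subset_connectedComponentIn
      ((isPreconnected_symplectizationLift ξ isPreconnected_connectedComponentIn).image _
        (continuousOn_id.prodMk (hcontf.mono fun c hc => ⟨hc.1, hsub hc.2⟩))) ?_ ?_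
    · rw [← h2]; exact ⟨hc₀, mem_connectedComponentIn (hCΛ _ hc₀)⟩
    · rw [← h2]; exact fun c hc => hc.1

end Symplectization

/-! ### Parametrizations of `SΛ` and of its Legendrian graphs -/

section LocalParam

theorem injective_fderiv_of_leftInverse {G K : Type*} [NormedAddCommGroup G] [NormedSpace ℝ G]
    [NormedAddCommGroup K] [NormedSpace ℝ K] {f : G → K} {g : K → G} {u : G}
    (hf : DifferentiableAt ℝ f u) (hg : DifferentiableAt ℝ g (f u))
    (h : Function.LeftInverse g f) : Function.Injective (fderiv ℝ f u) := by
  have h1 : fderiv ℝ (g ∘ f) u = ContinuousLinearMap.id ℝ G := by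
    rw [h.comp_eq_id, fderiv_id]
  rw [fderiv_comp u hg hf] at h1
  exact Function.LeftInverse.injective (g := fderiv ℝ g (f u)) fun w =>
    DFunLike.congr_fun h1 w

section

variable {E H X : Type*} [NormedAddCommGroup E] [NormedSpace ℝ E] [TopologicalSpace H]
  {I : ModelWithCorners ℝ E H} [TopologicalSpace X] [ChartedSpace H X]

theorem injective_mfderiv_comp_of_injective_fderiv {G K : Type*} [NormedAddCommGroup G]
    [NormedSpace ℝ G] [NormedAddCommGroup K] [NormedSpace ℝ K] {f : G → K} {σ : K → X} {u : G}
    (hσ : MDifferentiableAt 𝓘(ℝ, K) I σ (f u)) (hf : DifferentiableAt ℝ f u)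
    (hσi : Function.Injective (mfderiv 𝓘(ℝ, K) I σ (f u)))
    (hfi : Function.Injective (fderiv ℝ f u)) :
    Function.Injective (mfderiv 𝓘(ℝ, G) I (σ ∘ f) u) := by
  rw [mfderiv_comp u hσ hf.mdifferentiableAt, mfderiv_eq_fderiv]
  exact hσi.comp hfi

/-- A submanifold has parametrizations with values in a given neighbourhood of a given point. -/
theorem IsLocalParam.exists_range_subset {k : ℕ} {L : Set X} {σ : EuclideanSpace ℝ (Fin k) → X}
    (hσ : IsLocalParam I k L σ) {x : X} (hx : x ∈ range σ) {U : Set X} (hU : IsOpen U)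
    (hxU : x ∈ U) : ∃ τ : EuclideanSpace ℝ (Fin k) → X, IsLocalParam I k L τ ∧ x ∈ range τ ∧
      range τ ⊆ U := by
  obtain ⟨v₀, rfl⟩ := hx
  obtain ⟨r, hr, hball⟩ := Metric.isOpen_iff.1 (hU.preimage hσ.embedding.continuous) v₀ hxU
  -- A diffeomorphism of the whole Euclidean space onto a small ball, since a parametrization must
  -- be defined everywhere.
  set φ := OpenPartialHomeomorph.univBall v₀ r with hφ
  have hφs : ContDiff ℝ ∞ φ := OpenPartialHomeomorph.contDiff_univBall
  have hsource : φ.source = univ := OpenPartialHomeomorph.univBall_source v₀ r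
  have htarget : φ.target = Metric.ball v₀ r := OpenPartialHomeomorph.univBall_target v₀ hr
  have hmem : ∀ v, φ v ∈ Metric.ball v₀ r := fun v => by
    rw [← htarget]; exact φ.map_source (hsource ▸ mem_univ v)
  have hopen : IsOpenEmbedding φ := φ.isOpenEmbedding hsource
  have hrange : range φ = Metric.ball v₀ r := by
    rw [← image_univ, ← hsource, φ.image_source_eq_target, htarget]
  refine ⟨σ ∘ φ, ⟨hσ.smooth.comp hφs.contMDiff, hσ.embedding.comp hopen.isEmbedding,
    fun u => ?_, ?_⟩, ⟨0, ?_⟩, ?_⟩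
  · refine injective_mfderiv_comp_of_injective_fderiv
      ((hσ.smooth _).mdifferentiableAt (by simp)) (hφs.differentiable (by simp) u)
      (hσ.immersion _) (injective_fderiv_of_leftInverse (g := φ.symm)
        (hφs.differentiable (by simp) u) ?_ fun v => φ.left_inv (hsource ▸ mem_univ v))
    exact ((OpenPartialHomeomorph.contDiffOn_univBall_symm (n := (⊤ : ℕ∞))).contDiffAt
      (Metric.isOpen_ball.mem_nhds (hmem u))).differentiableAt (by simp)
  · obtain ⟨W, hW, hWr⟩ := hσ.range_open
    obtain ⟨W', hW', hWr'⟩ := hσ.embedding.isInducing.isOpen_iff.1 hopen.isOpen_range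
    refine ⟨W ∩ W', hW.inter hW', ?_⟩
    rw [range_comp, ← hWr', image_preimage_eq_inter_range, hWr]
    ext y
    simp only [mem_inter_iff]
    tauto
  · simp [hφ, OpenPartialHomeomorph.univBall_apply_zero]
  · rintro _ ⟨v, rfl⟩
    exact hball (hmem v)

/-- The graph of a function which is smooth along a parametrization. -/
theorem IsLocalParam.graph {k : ℕ} {L : Set X} {σ : EuclideanSpace ℝ (Fin k) → X}
    (hσ : IsLocalParam I k L σ) {f : X → ℝ} (hf : ContDiff ℝ ∞ (f ∘ σ)) {C : Set (X × ℝ)}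
    (hC : C = {c | c.1 ∈ L ∧ c.2 = f c.1}) :
    IsLocalParam (I.prod 𝓘(ℝ, ℝ)) k C fun u => (σ u, f (σ u)) := by
  have hs : ContMDiff 𝓘(ℝ, EuclideanSpace ℝ (Fin k)) (I.prod 𝓘(ℝ, ℝ)) ∞
      fun u => (σ u, f (σ u)) := hσ.smooth.prodMk hf.contMDiff
  refine ⟨hs, IsEmbedding.of_comp hs.continuous continuous_fst hσ.embedding, fun u => ?_, ?_⟩
  · have hd := (hs u).mdifferentiableAt (n := ∞) (by simp)
    refine Function.Injective.of_comp (f := mfderiv (I.prod 𝓘(ℝ, ℝ)) I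
      (Prod.fst : X × ℝ → X) (σ u, f (σ u))) ?_
    have := mfderiv_comp u (g := (Prod.fst : X × ℝ → X)) mdifferentiableAt_fst hd
    have h2 : Function.Injective (mfderiv 𝓘(ℝ, EuclideanSpace ℝ (Fin k)) I
      ((Prod.fst : X × ℝ → X) ∘ fun u => (σ u, f (σ u))) u) := hσ.immersion u
    rw [this] at h2
    exact h2
  · obtain ⟨W, hW, hWr⟩ := hσ.range_open
    refine ⟨W ×ˢ univ, hW.prod isOpen_univ, ?_⟩
    ext c
    rw [hC]
    constructor
    · rintro ⟨u, rfl⟩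
      have : σ u ∈ W ∩ L := hWr ▸ mem_range_self u
      exact ⟨⟨this.1, mem_univ _⟩, this.2, rfl⟩
    · rintro ⟨⟨h1, -⟩, h2, h3⟩
      obtain ⟨u, hu⟩ : c.1 ∈ range σ := hWr ▸ ⟨h1, h2⟩
      exact ⟨u, Prod.ext hu (by simp only; rw [hu, h3])⟩

theorem contactizationForm_apply (lam : ∀ x : X, TangentSpace I x →L[ℝ] ℝ) {G : Type*}
    [NormedAddCommGroup G] [NormedSpace ℝ G] {σ : G → X} {t : G → ℝ} {u : G}
    (hσ : MDifferentiableAt 𝓘(ℝ, G) I σ u) (ht : DifferentiableAt ℝ t u) (w : G) :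
    contactizationForm I lam (σ u, t u)
        (mfderiv 𝓘(ℝ, G) (I.prod 𝓘(ℝ, ℝ)) (fun y => (σ y, t y)) u w) =
      lam (σ u) (mfderiv 𝓘(ℝ, G) I σ u w) + fderiv ℝ t u w := by
  have hd : MDifferentiableAt 𝓘(ℝ, G) (I.prod 𝓘(ℝ, ℝ)) (fun y => (σ y, t y)) u :=
    hσ.prodMk ht.mdifferentiableAt
  have h1 := mfderiv_comp_apply u (g := (Prod.fst : X × ℝ → X)) mdifferentiableAt_fst hd w
  have h2 := mfderiv_comp_apply u (g := (Prod.snd : X × ℝ → ℝ)) (I' := I.prod 𝓘(ℝ, ℝ))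
    (I'' := 𝓘(ℝ, ℝ)) mdifferentiableAt_snd hd w
  have h3 : fderiv ℝ t u w = mfderiv 𝓘(ℝ, G) 𝓘(ℝ, ℝ) t u w := by
    rw [mfderiv_eq_fderiv]; rfl
  rw [h3]
  exact (congrArg₂ (fun (a b : ℝ) => a + b) (congrArg (lam (σ u)) h1) h2).symm

/-- Along the graph, `dt` becomes `df = -lam`, which cancels `lam`. -/
theorem isLegendrian_of_isPrimitiveOn {lam : ∀ x : X, TangentSpace I x →L[ℝ] ℝ} {S L : Set X}
    {k : ℕ} {f : X → ℝ} (hLS : L ⊆ S) (hf : IsPrimitiveOn I (fun x => -lam x) k L f)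
    {C : Set (X × ℝ)} (hC : C = {c | c.1 ∈ L ∧ c.2 = f c.1}) :
    IsLegendrian (I.prod 𝓘(ℝ, ℝ)) (contactization S) (contactizationPlane I lam) k C := by
  subst hC
  refine ⟨fun c hc => hLS hc.1, fun c hc => ?_⟩
  obtain ⟨σ, hσ, ⟨v, hv⟩, hfs, hd⟩ := hf c.1 hc.1
  refine ⟨fun u => (σ u, f (σ u)), hσ.graph hfs rfl, ⟨v, Prod.ext hv ?_⟩, fun u w => ?_⟩
  · simp only; rw [hv, hc.2]
  · change contactizationForm I lam (σ u, (f ∘ σ) u) _ = 0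
    refine (contactizationForm_apply lam ((hσ.smooth u).mdifferentiableAt (by simp))
      (hfs.differentiable (by simp) u) w).trans ?_
    exact (congrArg (lam (σ u) _ + ·) (hd u w)).trans (add_neg_cancel _)

end

variable {d : ℕ} {V : Type*} [TopologicalSpace V] [ChartedSpace (EuclideanSpace ℝ (Fin d)) V]
  [IsManifold (𝓡 d) ∞ V]

/-- The preimage of a Legendrian submanifold in the symplectization is a submanifold. -/
theorem IsLegendrian.exists_isLocalParam_symplectizationLift {ξ : CoorientedContactStructure d V}
    {M : Set V} {k : ℕ} {Λ : Set V} (hΛ : IsLegendrian (𝓡 d) M ξ.plane k Λ)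
    {c : CotangentTotal d V} (hc : c ∈ symplectizationLift ξ Λ) :
    ∃ σ : EuclideanSpace ℝ (Fin (k + 1)) → CotangentTotal d V,
      IsLocalParam (cotangentModel d) (k + 1) (symplectizationLift ξ Λ) σ ∧ c ∈ range σ := by
  obtain ⟨U, α, hU, hxU, hα, h⟩ := ξ.exists_section c.proj
  obtain ⟨σ₀, hσ₀, hx₀, -⟩ := hΛ.2 _ hc.2
  obtain ⟨σ, hσ, ⟨v₀, hv₀⟩, hσU⟩ := hσ₀.exists_range_subset hx₀ hU hxU
  -- A local contact form along `σ` is a section of `SV`; rescaling it by `exp r` sweeps out the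
  -- rays over the image of `σ`, which adds one dimension.
  set θ : EuclideanSpace ℝ (Fin k) → CotangentTotal d V := fun v => ⟨σ v, α (σ v)⟩ with hθ
  have hθs : ContMDiff 𝓘(ℝ, EuclideanSpace ℝ (Fin k)) (cotangentModel d) ∞ θ :=
    hα.comp_contMDiff hσ.smooth fun v => hσU (mem_range_self v)
  have hθS : ∀ v, θ v ∈ symplectization ξ := fun v => (h _ (hσU (mem_range_self v))).2
  have hΘ : ContMDiff 𝓘(ℝ, EuclideanSpace ℝ (Fin k) × ℝ) (cotangentModel d) ∞
      fun p : EuclideanSpace ℝ (Fin k) × ℝ => fiberScale (θ p.1) p.2 := fun p =>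
    ContMDiffWithinAt.fiberScale (mem_univ _)
      (hθs.comp (contDiff_fst.contMDiff) p) contDiff_snd.contMDiff.contMDiffAt
  let e : EuclideanSpace ℝ (Fin (k + 1)) ≃L[ℝ] EuclideanSpace ℝ (Fin k) × ℝ :=
    ContinuousLinearEquiv.ofFinrankEq (by simp)
  refine ⟨(fun p => fiberScale (θ p.1) p.2) ∘ e, ⟨hΘ.comp e.contDiff.contMDiff, ?_, fun u => ?_,
    ?_⟩, ?_⟩
  · exact (isEmbedding_fiberScale hθs.continuous hσ.embedding
      (fun v => snd_ne_zero_of_mem_symplectization (hθS v)) hΘ.continuous).comp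
      e.toHomeomorph.isEmbedding
  · refine injective_mfderiv_comp_of_injective_fderiv ((hΘ _).mdifferentiableAt (by simp))
      e.differentiableAt ?_ ?_
    · exact injective_mfderiv_fiberScale _ (hθs _) (hσ.immersion _)
        (snd_ne_zero_of_mem_symplectization (hθS _))
    · rw [e.fderiv]; exact e.injective
  · obtain ⟨W, hW, hWr⟩ := hσ.range_open
    refine ⟨TotalSpace.proj ⁻¹' W, hW.preimage (FiberBundle.continuous_proj _ _), ?_⟩
    rw [range_comp, e.surjective.range_eq, image_univ]
    ext c'
    constructor
    · rintro ⟨p, rfl⟩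
      have : σ p.1 ∈ W ∩ Λ := hWr ▸ mem_range_self p.1
      exact ⟨this.1, fiberScale_mem_symplectization (hθS _) _, this.2⟩
    · rintro ⟨h1, h2, h3⟩
      obtain ⟨v, hv⟩ : c'.proj ∈ range σ := hWr ▸ ⟨h1, h3⟩
      obtain ⟨r, hr⟩ := exists_eq_fiberScale (hθS v) h2 hv.symm
      exact ⟨(v, r), hr.symm⟩
  · obtain ⟨r, hr⟩ := exists_eq_fiberScale (hθS v₀) hc.1 hv₀.symm
    exact ⟨e.symm (v₀, r), by simp [hr]⟩

theorem IsLegendrian.isPrimitiveOn_zero {ξ : CoorientedContactStructure d V}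
    {M : Set V} {k : ℕ} {Λ : Set V} (hΛ : IsLegendrian (𝓡 d) M ξ.plane k Λ) :
    IsPrimitiveOn (cotangentModel d) (fun c => -canonicalForm d V c) (k + 1)
      (symplectizationLift ξ Λ) fun _ => 0 := by
  intro c hc
  obtain ⟨σ, hσ, hcσ⟩ := hΛ.exists_isLocalParam_symplectizationLift hc
  obtain ⟨W, -, hWr⟩ := id hσ.range_open
  refine ⟨σ, hσ, hcσ, contDiff_const, fun u w => ?_⟩
  have h0 := canonicalForm_mfderiv_eq_zero hΛ ((hσ.smooth u).mdifferentiableAt (by simp))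
    (fun y => (hWr ▸ mem_range_self y : σ y ∈ W ∩ _).2) w
  have h1 : fderiv ℝ ((fun _ : CotangentTotal d V => (0 : ℝ)) ∘ σ) u w = 0 := by
    simp [Function.comp_def]
  rw [h1]
  exact (neg_eq_zero.2 h0).symm

end LocalParam

/-! ### Restriction of contact charts and smooth pairing of forms with vectors -/

section ContactParam

open Filter

variable {E H X : Type*} [NormedAddCommGroup E] [NormedSpace ℝ E] [TopologicalSpace H]
  {I : ModelWithCorners ℝ E H} [TopologicalSpace X] [ChartedSpace H X]

theorem IsContactParam.mono {M : Set X} {ξ : ∀ x : X, Submodule ℝ (TangentSpace I x)} {m : ℕ}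
    {O O' : Set (LooseModel m)} {ψ : LooseModel m → X} (h : IsContactParam I M ξ m O ψ)
    (hO' : IsOpen O') (hsub : O' ⊆ O) : IsContactParam I M ξ m O' ψ where
  isOpen := hO'
  smooth := h.smooth.mono hsub
  embedding := h.embedding.comp (IsEmbedding.inclusion hsub)
  immersion u hu := h.immersion u (hsub hu)
  image_open := by
    obtain ⟨W, hW, hWr⟩ := h.image_open
    obtain ⟨W', hW', hWr'⟩ :=
      h.embedding.isInducing.isOpen_iff.1 (hO'.preimage continuous_subtype_val : IsOpen
        ((↑) ⁻¹' O' : Set O))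
    refine ⟨W ∩ W', hW.inter hW', ?_⟩
    have hiff : ∀ u (hu : u ∈ O), ψ u ∈ W' ↔ u ∈ O' := fun u hu =>
      Set.ext_iff.1 hWr' ⟨u, hu⟩
    ext x
    constructor
    · rintro ⟨u, hu, rfl⟩
      have : ψ u ∈ W ∩ M := hWr ▸ mem_image_of_mem ψ (hsub hu)
      exact ⟨⟨this.1, (hiff u (hsub hu)).2 hu⟩, this.2⟩
    · rintro ⟨⟨h1, h2⟩, h3⟩
      obtain ⟨u, hu, rfl⟩ : x ∈ ψ '' O := hWr ▸ ⟨h1, h3⟩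
      exact ⟨u, (hiff u hu).1 h2, rfl⟩
  contact u hu := h.contact u (hsub hu)

/-- The vector field `∂/∂z` of the standard contact space. -/
def zDirection (m : ℕ) : LooseModel m := ((0, 0, 1), 0, 0)

theorem stdContactForm_sub_smul_zDirection {m : ℕ} (u w : LooseModel m) (s : ℝ) :
    stdContactForm u (w - s • zDirection m) = stdContactForm u w - s := by
  simp [stdContactForm, zDirection]
  ring

theorem stdContactForm_zDirection {m : ℕ} (u : LooseModel m) :
    stdContactForm u (zDirection m) = 1 := by
  simp [stdContactForm, zDirection]

variable {d : ℕ} {V : Type*} [TopologicalSpace V] [ChartedSpace (EuclideanSpace ℝ (Fin d)) V]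
  [IsManifold (𝓡 d) ∞ V]

/-- The tangent map of `ψ` applied to the constant field `w` is a smooth field along `ψ`, and the
pairing of covectors with vectors is smooth. -/
theorem ContMDiffOn.form_apply_mfderiv {G : Type*} [NormedAddCommGroup G] [NormedSpace ℝ G]
    {α : ∀ x : V, TangentSpace (𝓡 d) x →L[ℝ] ℝ} {U : Set V}
    (hα : ContMDiffOn (𝓡 d) (cotangentModel d) ∞ (fun x => (⟨x, α x⟩ : CotangentTotal d V)) U)
    {O : Set G} {ψ : G → V} (hO : IsOpen O) (hψ : ContMDiffOn 𝓘(ℝ, G) (𝓡 d) ∞ ψ O)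
    (hOU : MapsTo ψ O U) (w : G) :
    ContMDiffOn 𝓘(ℝ, G) 𝓘(ℝ, ℝ) ∞ (fun u => α (ψ u) (mfderiv 𝓘(ℝ, G) (𝓡 d) ψ u w)) O := by
  have h1 : ContMDiffOn 𝓘(ℝ, G) (cotangentModel d) ∞
      (fun u => (⟨ψ u, α (ψ u)⟩ : CotangentTotal d V)) O := hα.comp hψ hOU
  have h2 : ContMDiffOn 𝓘(ℝ, G) ((𝓡 d).prod 𝓘(ℝ, EuclideanSpace ℝ (Fin d))) ∞
      (fun u => (⟨ψ u, mfderiv 𝓘(ℝ, G) (𝓡 d) ψ u w⟩ : TangentBundle (𝓡 d) V)) O := by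
    have h3 := hψ.contMDiffOn_tangentMapWithin (m := ∞) (by simp) hO.uniqueMDiffOn
    have h4 : ContMDiff 𝓘(ℝ, G) (𝓘(ℝ, G).prod 𝓘(ℝ, G)) ∞
        (fun u => (⟨u, w⟩ : TangentBundle 𝓘(ℝ, G) G)) := by
      intro u
      rw [contMDiffAt_totalSpace]
      refine ⟨contMDiffAt_id, ?_⟩
      simp
      exact contMDiffAt_const
    refine (h3.comp h4.contMDiffOn fun u hu => hu).congr fun u hu => ?_
    simp only [Function.comp, tangentMapWithin]
    rw [mfderivWithin_of_isOpen hO hu]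
  have h5 := ContMDiffOn.clm_bundle_apply (E₂ := Bundle.Trivial V ℝ) (b := ψ) h1 h2
  intro u hu
  have := (contMDiffWithinAt_totalSpace.1 (h5 u hu)).2
  simpa using this

end ContactParam

/-! ### Covectors along a contact chart that pull back to the standard form up to sign -/

section CovectorLift

open Filter

variable {d : ℕ} {V : Type*} [TopologicalSpace V] [ChartedSpace (EuclideanSpace ℝ (Fin d)) V]
  [IsManifold (𝓡 d) ∞ V] {ξ : CoorientedContactStructure d V} {m : ℕ} {O : Set (LooseModel m)}
  {ψ : LooseModel m → V}

/-- The image of `∂/∂z` by `ψ` is on the positive side of the contact structure. -/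
def IsPositiveAt (ξ : CoorientedContactStructure d V) (ψ : LooseModel m → V) (u : LooseModel m) :
    Prop :=
  mfderiv 𝓘(ℝ, LooseModel m) (𝓡 d) ψ u (zDirection m) ∈ ξ.positive (ψ u)

theorem IsContactParam.mfderiv_zDirection_notMem
    (h : IsContactParam (𝓡 d) univ ξ.plane m O ψ) {u : LooseModel m} (hu : u ∈ O) :
    mfderiv 𝓘(ℝ, LooseModel m) (𝓡 d) ψ u (zDirection m) ∉ ξ.plane (ψ u) := by
  rw [h.contact u hu, stdContactForm_zDirection]
  exact one_ne_zero

theorem IsContactParam.exists_local_form (h : IsContactParam (𝓡 d) univ ξ.plane m O ψ)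
    {u : LooseModel m} (hu : u ∈ O) :
    ∃ (N : Set (LooseModel m)) (α : ∀ x : V, TangentSpace (𝓡 d) x →L[ℝ] ℝ),
      IsOpen N ∧ u ∈ N ∧ N ⊆ O ∧
      ContMDiffOn 𝓘(ℝ, LooseModel m) (cotangentModel d) ∞
        (fun y => (⟨ψ y, α (ψ y)⟩ : CotangentTotal d V)) N ∧
      ContMDiffOn 𝓘(ℝ, LooseModel m) 𝓘(ℝ, ℝ) ∞ (fun y => α (ψ y)
        (mfderiv 𝓘(ℝ, LooseModel m) (𝓡 d) ψ y (zDirection m))) N ∧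
      ∀ y ∈ N, (⟨ψ y, α (ψ y)⟩ : CotangentTotal d V) ∈ symplectization ξ := by
  obtain ⟨U, α, hU, hxU, hα, hS⟩ := ξ.exists_section (ψ u)
  have hN : IsOpen (O ∩ ψ ⁻¹' U) := h.smooth.continuousOn.isOpen_inter_preimage h.isOpen hU
  have hψN := h.smooth.mono (inter_subset_left : O ∩ ψ ⁻¹' U ⊆ O)
  exact ⟨O ∩ ψ ⁻¹' U, α, hN, ⟨hu, hxU⟩, inter_subset_left, hα.comp hψN fun y hy => hy.2,
    ContMDiffOn.form_apply_mfderiv hα hN hψN (fun y hy => hy.2) _, fun y hy => (hS _ hy.2).2⟩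

/-- A local contact form evaluated on the image of `∂/∂z` is continuous and never zero, so its sign
is locally constant. -/
theorem IsContactParam.eventually_isPositiveAt (h : IsContactParam (𝓡 d) univ ξ.plane m O ψ)
    {u : LooseModel m} (hu : u ∈ O) :
    ∀ᶠ y in 𝓝[O] u, IsPositiveAt ξ ψ y = IsPositiveAt ξ ψ u := by
  obtain ⟨N, α, hN, huN, hNO, -, hs, hS⟩ := h.exists_local_form hu
  have hcont := (hs.continuousOn).continuousAt (hN.mem_nhds huN)
  have hne : ∀ y ∈ N, α (ψ y) (mfderiv 𝓘(ℝ, LooseModel m) (𝓡 d) ψ y (zDirection m)) ≠ 0 :=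
    fun y hy h0 => h.mfderiv_zDirection_notMem (hNO hy) (((hS y hy).1 _).2 h0)
  apply Filter.Eventually.filter_mono nhdsWithin_le_nhds
  rcases lt_or_gt_of_ne (hne u huN) with hlt | hgt
  · filter_upwards [hcont.eventually_lt_const hlt, hN.mem_nhds huN] with y hy hyN
    exact propext (iff_of_false (fun hp => lt_asymm hy (((hS y hyN).2 _).1 hp))
      (fun hp => lt_asymm hlt (((hS u huN).2 _).1 hp)))
  · filter_upwards [hcont.eventually_const_lt hgt, hN.mem_nhds huN] with y hy hyN
    exact propext (iff_of_true (((hS y hyN).2 _).2 hy) (((hS u huN).2 _).2 hgt))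

/-- Subtracting the right multiple of `∂/∂z` moves `w` into the standard contact plane, which `ψ`
sends into the kernel of `b`. -/
theorem apply_mfderiv_eq_mul_stdContactForm (h : IsContactParam (𝓡 d) univ ξ.plane m O ψ)
    {u : LooseModel m} (hu : u ∈ O) {b : TangentSpace (𝓡 d) (ψ u) →L[ℝ] ℝ}
    (hb : (⟨ψ u, b⟩ : CotangentTotal d V) ∈ symplectization ξ) (w : LooseModel m) :
    b (mfderiv 𝓘(ℝ, LooseModel m) (𝓡 d) ψ u w) =
      stdContactForm u w * b (mfderiv 𝓘(ℝ, LooseModel m) (𝓡 d) ψ u (zDirection m)) := by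
  have h1 : b (mfderiv 𝓘(ℝ, LooseModel m) (𝓡 d) ψ u
      (w - stdContactForm u w • zDirection m)) = 0 := by
    refine (hb.1 _).1 ((h.contact u hu _).2 ?_)
    rw [stdContactForm_sub_smul_zDirection, sub_self]
  have h2 : mfderiv 𝓘(ℝ, LooseModel m) (𝓡 d) ψ u (w - stdContactForm u w • zDirection m) =
      mfderiv 𝓘(ℝ, LooseModel m) (𝓡 d) ψ u w -
        stdContactForm u w • mfderiv 𝓘(ℝ, LooseModel m) (𝓡 d) ψ u (zDirection m) := by
    exact ((mfderiv 𝓘(ℝ, LooseModel m) (𝓡 d) ψ u).map_sub _ _).trans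
      (congrArg _ ((mfderiv 𝓘(ℝ, LooseModel m) (𝓡 d) ψ u).map_smul _ _))
  rw [h2, map_sub, map_smul, smul_eq_mul, sub_eq_zero] at h1
  exact h1

/-- On each ray there is a unique covector with value `ε` on the image of `∂/∂z`. Uniqueness
identifies the pointwise choice with a smooth local formula, and this one value determines the whole
pullback. -/
theorem IsContactParam.exists_covector_lift (h : IsContactParam (𝓡 d) univ ξ.plane m O ψ) {ε : ℝ}
    (hε : ε = 1 ∨ ε = -1) (hpos : ∀ u ∈ O, IsPositiveAt ξ ψ u ↔ 0 < ε) :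
    ∃ b : ∀ u : LooseModel m, TangentSpace (𝓡 d) (ψ u) →L[ℝ] ℝ,
      ContMDiffOn 𝓘(ℝ, LooseModel m) (cotangentModel d) ∞
        (fun u => (⟨ψ u, b u⟩ : CotangentTotal d V)) O ∧
      ∀ u ∈ O, (⟨ψ u, b u⟩ : CotangentTotal d V) ∈ symplectization ξ ∧
        ∀ w : LooseModel m, b u (mfderiv 𝓘(ℝ, LooseModel m) (𝓡 d) ψ u w) = ε * stdContactForm u w := by
  have hεε : ε * ε = 1 := by rcases hε with rfl | rfl <;> norm_num
  have hε0 : ε ≠ 0 := by rintro rfl; simp at hεε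
  set D : LooseModel m → EuclideanSpace ℝ (Fin d) := fun u =>
    mfderiv 𝓘(ℝ, LooseModel m) (𝓡 d) ψ u (zDirection m) with hD
  have hval : ∀ u ∈ O, ∀ b : TangentSpace (𝓡 d) (ψ u) →L[ℝ] ℝ,
      (⟨ψ u, b⟩ : CotangentTotal d V) ∈ symplectization ξ → 0 < ε * b (D u) := by
    intro u hu b hb
    have hne : b (D u) ≠ 0 := fun h0 => h.mfderiv_zDirection_notMem hu ((hb.1 _).2 h0)
    have hiff : 0 < b (D u) ↔ 0 < ε := (hb.2 _).symm.trans (hpos u hu)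
    rcases hε with rfl | rfl
    · simpa using hiff.2 one_pos
    · have : ¬ 0 < b (D u) := fun h' => by have := hiff.1 h'; norm_num at this
      have := lt_of_le_of_ne (not_lt.1 this) hne
      linarith
  have hex : ∀ u, ∃ b : TangentSpace (𝓡 d) (ψ u) →L[ℝ] ℝ, u ∈ O →
      (⟨ψ u, b⟩ : CotangentTotal d V) ∈ symplectization ξ ∧ b (D u) = ε := by
    intro u
    by_cases hu : u ∈ O
    · obtain ⟨N, α, -, huN, -, -, -, hS⟩ := h.exists_local_form hu
      have hp := hval u hu _ (hS u huN)
      -- Scaling by the inverse of `ε α(D u) > 0` turns the value `α(D u)` into `1/ε`, which is `ε`.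
      refine ⟨(fiberScale (⟨ψ u, α (ψ u)⟩ : CotangentTotal d V)
        (-Real.log (ε * α (ψ u) (D u)))).2, fun _ =>
        ⟨fiberScale_mem_symplectization (hS u huN) _, ?_⟩⟩
      change Real.exp (-Real.log (ε * α (ψ u) (D u))) * α (ψ u) (D u) = ε
      rw [Real.exp_neg, Real.exp_log hp]
      have := right_ne_zero_of_mul hp.ne'
      field_simp
      rw [sq, hεε]
    · exact ⟨0, fun h => absurd h hu⟩
  choose b hb using hex
  refine ⟨b, fun u hu => ?_, fun u hu => ⟨(hb u hu).1, fun w => ?_⟩⟩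
  · obtain ⟨N, α, hN, huN, hNO, hα, hs, hS⟩ := h.exists_local_form hu
    refine ContMDiffAt.contMDiffWithinAt ?_
    have hp := fun y hy => hval y (hNO hy) _ (hS y hy)
    have hlog : ContMDiffAt 𝓘(ℝ, LooseModel m) 𝓘(ℝ, ℝ) ∞
        (fun y => -Real.log (ε * α (ψ y) (D y))) u := by
      have h1 := hs.contMDiffAt (hN.mem_nhds huN)
      have h2 : ContDiffAt ℝ ∞ (fun t : ℝ => -Real.log (ε * t)) (α (ψ u) (D u)) :=
        ((contDiffAt_const.mul contDiffAt_id).log (hp u huN).ne').neg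
      exact ContMDiffAt.comp (I' := 𝓘(ℝ, ℝ)) u (g := fun t : ℝ => -Real.log (ε * t))
        (f := fun y => α (ψ y) (D y)) h2.contMDiffAt h1
    have hfs : ContMDiffAt 𝓘(ℝ, LooseModel m) (cotangentModel d) ∞
        (fun y => fiberScale (⟨ψ y, α (ψ y)⟩ : CotangentTotal d V)
          (-Real.log (ε * α (ψ y) (D y)))) u :=
      ContMDiffWithinAt.fiberScale (mem_univ _) (hα.contMDiffAt (hN.mem_nhds huN)) hlog
    refine hfs.congr_of_eventuallyEq ?_
    filter_upwards [hN.mem_nhds huN] with y hy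
    obtain ⟨r, hr⟩ := exists_eq_fiberScale (hS y hy) (hb y (hNO hy)).1 rfl
    have hr' : b y = Real.exp r • α (ψ y) := by
      simpa [fiberScale] using hr
    have h3 : ε = Real.exp r * α (ψ y) (D y) := by
      rw [← (hb y (hNO hy)).2, hr']; rfl
    have h4 : ε * α (ψ y) (D y) = Real.exp (-r) := by
      rw [Real.exp_neg]
      refine eq_inv_of_mul_eq_one_left ?_
      calc ε * α (ψ y) (D y) * Real.exp r = ε * (Real.exp r * α (ψ y) (D y)) := by ring
        _ = 1 := by rw [← h3, hεε]
    rw [hr, h4, Real.log_exp, neg_neg]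
  · exact (apply_mfderiv_eq_mul_stdContactForm h hu (hb u hu).1 w).trans
      ((congrArg _ (hb u hu).2).trans (mul_comm _ _))

end CovectorLift

/-! ### The explicit change of coordinates -/

section ContactizedChart

variable {m : ℕ}

/-- The projection `(p, q, z, x, y) ↦ (p, q, z - κ y₀, (x₁, …), (y₁, …))`. -/
def looseProj (m : ℕ) (κ : ℝ) : LooseModel (m + 1) →L[ℝ] LooseModel m :=
  LinearMap.toContinuousLinearMap
    { toFun := fun u => ((u.1.1, u.1.2.1, u.1.2.2 - κ * u.2.2 0), fun i => u.2.1 i.succ,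
        fun i => u.2.2 i.succ)
      map_add' := fun u v => by
        ext <;> simp
        ring
      map_smul' := fun s u => by
        ext <;> simp
        ring }

theorem looseProj_apply (κ : ℝ) (u : LooseModel (m + 1)) :
    looseProj m κ u = ((u.1.1, u.1.2.1, u.1.2.2 - κ * u.2.2 0), fun i => u.2.1 i.succ,
      fun i => u.2.2 i.succ) := rfl

/-- The logarithmic fibre coordinate of the symplectization. -/
def looseFiber (m : ℕ) (κ : ℝ) : LooseModel (m + 1) →L[ℝ] ℝ :=
  LinearMap.toContinuousLinearMap
    { toFun := fun u => -(κ⁻¹ * u.2.1 0)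
      map_add' := fun u v => by simp; ring
      map_smul' := fun s u => by simp; ring }

theorem looseFiber_apply (κ : ℝ) (u : LooseModel (m + 1)) :
    looseFiber m κ u = -(κ⁻¹ * u.2.1 0) := rfl

/-- The additional coordinate of the contactization. -/
def looseHeight (κ ε c : ℝ) (u : LooseModel (m + 1)) : ℝ :=
  c + ε * κ * (Real.exp (looseFiber m κ u) * u.2.2 0)

/-- The change of coordinates from `ℝ³ × ℝ^(2m+2)` to the product of `ℝ³ × ℝ^(2m)` with the fibre
coordinate of the symplectization and the additional coordinate of the contactization. -/
def looseSplit (κ ε c : ℝ) (u : LooseModel (m + 1)) : (LooseModel m × ℝ) × ℝ :=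
  ((looseProj m κ u, looseFiber m κ u), looseHeight κ ε c u)

/-- The inverse of `looseSplit`. -/
def looseSplitInv (κ ε c : ℝ) (v : (LooseModel m × ℝ) × ℝ) : LooseModel (m + 1) :=
  ((v.1.1.1.1, v.1.1.1.2.1, v.1.1.1.2.2 + ε * (Real.exp (-v.1.2) * (v.2 - c))),
    Fin.cons (-(κ * v.1.2)) v.1.1.2.1, Fin.cons (ε * κ⁻¹ * (Real.exp (-v.1.2) * (v.2 - c))) v.1.1.2.2)

variable {κ ε c : ℝ}

theorem contDiff_looseHeight : ContDiff ℝ ∞ (looseHeight (m := m) κ ε c) := by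
  unfold looseHeight
  fun_prop

theorem contDiff_looseSplit : ContDiff ℝ ∞ (looseSplit (m := m) κ ε c) :=
  ((looseProj m κ).contDiff.prodMk (looseFiber m κ).contDiff).prodMk contDiff_looseHeight

theorem contDiff_looseSplitInv : ContDiff ℝ ∞ (looseSplitInv (m := m) κ ε c) := by
  unfold looseSplitInv
  refine ContDiff.prodMk (by fun_prop) (ContDiff.prodMk ?_ ?_)
  all_goals
    refine contDiff_pi.2 fun i => ?_
    refine Fin.cases ?_ (fun j => ?_) i
    · simp only [Fin.cons_zero]; fun_prop
    · simp only [Fin.cons_succ]; fun_prop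

theorem leftInverse_looseSplitInv (hκ : κ ≠ 0) (hε : ε * ε = 1) :
    Function.LeftInverse (looseSplitInv (m := m) κ ε c) (looseSplit κ ε c) := by
  intro u
  -- This recovers `y₀`, and with it the shift that restores `z`.
  have hexp : Real.exp (-looseFiber m κ u) * (looseHeight κ ε c u - c) = ε * κ * u.2.2 0 := by
    rw [looseHeight, add_sub_cancel_left, Real.exp_neg]
    field_simp [Real.exp_ne_zero]
  simp only [looseSplitInv, looseSplit, hexp]
  refine Prod.ext (Prod.ext rfl (Prod.ext rfl ?_)) (Prod.ext ?_ ?_)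
  · simp only [looseProj_apply]
    linear_combination κ * u.2.2 0 * hε
  · funext i
    refine Fin.cases ?_ (fun j => ?_) i
    · simp only [Fin.cons_zero, looseFiber_apply]; field_simp
    · rfl
  · funext i
    refine Fin.cases ?_ (fun j => ?_) i
    · simp only [Fin.cons_zero]
      field_simp
      linear_combination u.2.2 0 * hε
    · rfl

theorem looseSplit_looseSplitInv (hκ : κ ≠ 0) (hε : ε * ε = 1) (v : (LooseModel m × ℝ) × ℝ) :
    looseSplit κ ε c (looseSplitInv κ ε c v) = v := by
  obtain ⟨⟨⟨⟨p, q, z⟩, x, y⟩, r⟩, t⟩ := v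
  have hf : looseFiber m κ (looseSplitInv κ ε c ⟨⟨⟨⟨p, q, z⟩, x, y⟩, r⟩, t⟩) = r := by
    simp only [looseFiber_apply, looseSplitInv, Fin.cons_zero]; field_simp
  refine Prod.ext (Prod.ext ?_ hf) ?_
  · simp only [looseSplit, looseProj_apply, looseSplitInv, Fin.cons_zero, Fin.cons_succ]
    refine Prod.ext (Prod.ext rfl (Prod.ext rfl ?_)) rfl
    simp only
    field_simp
    ring
  · simp only [looseSplit, looseHeight, hf]
    simp only [looseSplitInv, Fin.cons_zero, Real.exp_neg]
    field_simp [Real.exp_ne_zero]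
    linear_combination (t - c) * hε

theorem injective_looseSplit_fderiv (hκ : κ ≠ 0) (hε : ε * ε = 1) (u : LooseModel (m + 1)) :
    Function.Injective (fderiv ℝ (looseSplit κ ε c) u) :=
  injective_fderiv_of_leftInverse (contDiff_looseSplit.differentiable (by simp) u)
    (contDiff_looseSplitInv.differentiable (by simp) _) (leftInverse_looseSplitInv hκ hε)

theorem isEmbedding_looseSplit (hκ : κ ≠ 0) (hε : ε * ε = 1) :
    IsEmbedding (looseSplit (m := m) κ ε c) :=
  (leftInverse_looseSplitInv hκ hε).isEmbedding contDiff_looseSplitInv.continuous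
    contDiff_looseSplit.continuous

theorem fderiv_looseHeight (u w : LooseModel (m + 1)) :
    fderiv ℝ (looseHeight κ ε c) u w = ε * κ * (Real.exp (looseFiber m κ u) * w.2.2 0 +
      Real.exp (looseFiber m κ u) * looseFiber m κ w * u.2.2 0) := by
  let Y : LooseModel (m + 1) →L[ℝ] ℝ :=
    (ContinuousLinearMap.proj (R := ℝ) (φ := fun _ : Fin (m + 1) => ℝ) 0).comp
      ((ContinuousLinearMap.snd ℝ (Fin (m + 1) → ℝ) (Fin (m + 1) → ℝ)).comp
        (ContinuousLinearMap.snd ℝ (ℝ × ℝ × ℝ) ((Fin (m + 1) → ℝ) × (Fin (m + 1) → ℝ))))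
  have hy : HasFDerivAt (fun u : LooseModel (m + 1) => u.2.2 0) Y u := Y.hasFDerivAt
  have h := ((((looseFiber m κ).hasFDerivAt (x := u)).exp.mul hy).const_mul (ε * κ)).const_add c
  have h' : HasFDerivAt (looseHeight κ ε c) _ u := h
  rw [h'.fderiv]
  simp [Y]
  ring

/-- Since `κ dr = -dx₀`, the height contributes `dt = ε e^r (κ dy₀ - y₀ dx₀)`. The first term
cancels the `-κ dy₀` produced by the shift of `z`; the second is the missing summand of the larger
standard form. -/
theorem stdContactForm_looseProj (hκ : κ ≠ 0) (u w : LooseModel (m + 1)) :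
    Real.exp (looseFiber m κ u) * (ε * stdContactForm (looseProj m κ u) (looseProj m κ w)) +
      fderiv ℝ (looseHeight κ ε c) u w =
    Real.exp (looseFiber m κ u) * ε * stdContactForm u w := by
  rw [fderiv_looseHeight]
  simp only [stdContactForm, looseProj_apply, Fin.sum_univ_succ, looseFiber_apply κ w]
  field_simp
  ring

end ContactizedChart

/-! ### The contact chart of the contactization -/

section ContactizedChart

theorem eq_zero_of_mfderiv_eq_zero {E H X : Type*} [NormedAddCommGroup E] [NormedSpace ℝ E]
    [TopologicalSpace H] {I : ModelWithCorners ℝ E H} [TopologicalSpace X] [ChartedSpace H X]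
    {G : Type*} [NormedAddCommGroup G] [NormedSpace ℝ G] {σ : G → X} {u w : G}
    (h : Function.Injective (mfderiv 𝓘(ℝ, G) I σ u)) (hw : mfderiv 𝓘(ℝ, G) I σ u w = 0) : w = 0 :=
  (injective_iff_map_eq_zero _).1 h w hw

theorem injective_mfderiv_prodMk {E H X : Type*} [NormedAddCommGroup E] [NormedSpace ℝ E]
    [TopologicalSpace H] {I : ModelWithCorners ℝ E H} [TopologicalSpace X] [ChartedSpace H X]
    {G : Type*} [NormedAddCommGroup G] [NormedSpace ℝ G] {σ : G → X} {t : G → ℝ} {u : G}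
    (hσ : MDifferentiableAt 𝓘(ℝ, G) I σ u) (ht : DifferentiableAt ℝ t u)
    (h : ∀ w : G, mfderiv 𝓘(ℝ, G) I σ u w = 0 → fderiv ℝ t u w = 0 → w = 0) :
    Function.Injective (mfderiv 𝓘(ℝ, G) (I.prod 𝓘(ℝ, ℝ)) (fun y => (σ y, t y)) u) := by
  have hd : MDifferentiableAt 𝓘(ℝ, G) (I.prod 𝓘(ℝ, ℝ)) (fun y => (σ y, t y)) u :=
    hσ.prodMk ht.mdifferentiableAt
  rw [injective_iff_map_eq_zero]
  intro w hw
  refine h w ?_ ?_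
  · exact (mfderiv_comp_apply u (g := (Prod.fst : X × ℝ → X)) mdifferentiableAt_fst hd w).trans
      ((congrArg _ hw).trans (map_zero _))
  · have h3 : fderiv ℝ t u w = mfderiv 𝓘(ℝ, G) 𝓘(ℝ, ℝ) t u w := by
      rw [mfderiv_eq_fderiv]; rfl
    exact h3.trans ((mfderiv_comp_apply u (g := (Prod.snd : X × ℝ → ℝ)) (I' := I.prod 𝓘(ℝ, ℝ))
      (I'' := 𝓘(ℝ, ℝ)) mdifferentiableAt_snd hd w).trans ((congrArg _ hw).trans (map_zero _)))

variable {d : ℕ} {V : Type*} [TopologicalSpace V] [ChartedSpace (EuclideanSpace ℝ (Fin d)) V]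
  [IsManifold (𝓡 d) ∞ V] {ξ : CoorientedContactStructure d V} {m : ℕ} {O : Set (LooseModel m)}
  {ψ : LooseModel m → V} {κ ε : ℝ}

/-- The map to the contactization of the symplectization which is defined by a map `ψ` from the
standard contact space and covectors `b` along `ψ`. -/
def contactizedChart (ψ : LooseModel m → V)
    (b : ∀ u : LooseModel m, TangentSpace (𝓡 d) (ψ u) →L[ℝ] ℝ) (κ ε c : ℝ)
    (u : LooseModel (m + 1)) : CotangentTotal d V × ℝ :=
  (fiberScale (⟨ψ (looseProj m κ u), b (looseProj m κ u)⟩ : CotangentTotal d V)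
    (looseFiber m κ u), looseHeight κ ε c u)

/-- The map is `looseSplit` followed by scaling of the covectors `b`, with the height carried along,
so it inherits embedding and immersion from both. The pulled back contact form is `ε e^r` times the
standard one, with the same kernel. -/
theorem IsContactParam.contactizedChart (h : IsContactParam (𝓡 d) univ ξ.plane m O ψ)
    (hκ : κ ≠ 0) (hε : ε * ε = 1) (c : ℝ)
    {b : ∀ u : LooseModel m, TangentSpace (𝓡 d) (ψ u) →L[ℝ] ℝ}
    (hbs : ContMDiffOn 𝓘(ℝ, LooseModel m) (cotangentModel d) ∞
      (fun u => (⟨ψ u, b u⟩ : CotangentTotal d V)) O)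
    (hbS : ∀ u ∈ O, (⟨ψ u, b u⟩ : CotangentTotal d V) ∈ symplectization ξ)
    (hb : ∀ u ∈ O, ∀ w : LooseModel m,
      b u (mfderiv 𝓘(ℝ, LooseModel m) (𝓡 d) ψ u w) = ε * stdContactForm u w) :
    IsContactParam ((cotangentModel d).prod 𝓘(ℝ, ℝ)) (contactization (symplectization ξ))
      (contactizationPlane (cotangentModel d) (canonicalForm d V)) (m + 1)
      (looseProj m κ ⁻¹' O) (contactizedChart ψ b κ ε c) := by
  have hO' : IsOpen (looseProj m κ ⁻¹' O) := h.isOpen.preimage (looseProj m κ).continuous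
  set θ : LooseModel m → CotangentTotal d V := fun u => ⟨ψ u, b u⟩ with hθ
  set σ : LooseModel (m + 1) → CotangentTotal d V := fun u =>
    fiberScale (θ (looseProj m κ u)) (looseFiber m κ u) with hσ
  have hσs : ContMDiffOn 𝓘(ℝ, LooseModel (m + 1)) (cotangentModel d) ∞ σ (looseProj m κ ⁻¹' O) :=
    fun u hu => ContMDiffWithinAt.fiberScale hu
      ((hbs.comp (looseProj m κ).contDiff.contMDiff.contMDiffOn fun u hu => hu) u hu)
      (looseFiber m κ).contDiff.contMDiff.contMDiffAt.contMDiffWithinAt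
  have hs : ContMDiffOn 𝓘(ℝ, LooseModel (m + 1)) ((cotangentModel d).prod 𝓘(ℝ, ℝ)) ∞
      (_root_.contactizedChart ψ b κ ε c) (looseProj m κ ⁻¹' O) :=
    hσs.prodMk contDiff_looseHeight.contMDiff.contMDiffOn
  have hσd : ∀ u ∈ looseProj m κ ⁻¹' O,
      MDifferentiableAt 𝓘(ℝ, LooseModel (m + 1)) (cotangentModel d) σ u := fun u hu =>
    (hσs.contMDiffAt (hO'.mem_nhds hu)).mdifferentiableAt (by simp)
  have hhd : ∀ u, DifferentiableAt ℝ (looseHeight (m := m) κ ε c) u := fun u =>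
    contDiff_looseHeight.differentiable (by simp) u
  have hθd : ∀ v ∈ O, ContMDiffAt 𝓘(ℝ, LooseModel m) (cotangentModel d) ∞ θ v := fun v hv =>
    hbs.contMDiffAt (h.isOpen.mem_nhds hv)
  refine ⟨hO', hs, ?_, fun u hu => ?_, ?_, fun u hu w => ?_⟩
  · have hΘ : Continuous fun p : O × ℝ => fiberScale (θ p.1) p.2 := by
      have h1 : ContMDiffOn 𝓘(ℝ, LooseModel m × ℝ) (cotangentModel d) ∞
          (fun p : LooseModel m × ℝ => fiberScale (θ p.1) p.2) (Prod.fst ⁻¹' O) := fun p hp =>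
        ContMDiffWithinAt.fiberScale hp
          ((hbs.comp (contDiff_fst.contMDiff.contMDiffOn) fun u hu => hu) p hp)
          contDiff_snd.contMDiff.contMDiffAt.contMDiffWithinAt
      exact h1.continuousOn.comp_continuous
        (f := fun p : O × ℝ => ((p.1 : LooseModel m), p.2)) (by fun_prop) fun p => p.1.2
    have h2 := isEmbedding_fiberScale (θ := fun u : O => θ u) hbs.continuousOn.domRestrict
      h.embedding (fun u => snd_ne_zero_of_mem_symplectization (hbS u u.2)) hΘ
    have h3 : IsEmbedding fun u : looseProj m κ ⁻¹' O =>
        (((⟨looseProj m κ u, u.2⟩ : O), looseFiber m κ u),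
          looseHeight κ ε c (u : LooseModel (m + 1))) := by
      refine IsEmbedding.of_comp (g := fun p : (O × ℝ) × ℝ => (((p.1.1 : LooseModel m), p.1.2), p.2))
        ?_ (by fun_prop) ((isEmbedding_looseSplit hκ hε).comp IsEmbedding.subtypeVal)
      have := (contDiff_looseHeight (m := m) (κ := κ) (ε := ε) (c := c)).continuous
      fun_prop
    exact (h2.prodMap IsEmbedding.id).comp h3
  · refine injective_mfderiv_prodMk (hσd u hu) (hhd u) fun w hw hw' => ?_
    have hd : DifferentiableAt ℝ (fun u => (looseProj m κ u, looseFiber m κ u)) u :=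
      ((looseProj m κ).differentiableAt).prodMk (looseFiber m κ).differentiableAt
    have hΘd : MDifferentiableAt 𝓘(ℝ, LooseModel m × ℝ) (cotangentModel d)
        (fun p : LooseModel m × ℝ => fiberScale (θ p.1) p.2)
        (looseProj m κ u, looseFiber m κ u) :=
      ContMDiffAt.mdifferentiableAt (n := ∞) (ContMDiffWithinAt.fiberScale (mem_univ _)
        (ContMDiffAt.comp _ (g := θ) (hθd _ hu) contDiff_fst.contMDiff.contMDiffAt)
        contDiff_snd.contMDiff.contMDiffAt) (by simp)
    have h1 := injective_mfderiv_fiberScale (looseFiber m κ u) (hθd _ hu)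
      (h.immersion _ hu) (snd_ne_zero_of_mem_symplectization (hbS _ hu))
    have h2 := (mfderiv_comp_apply u hΘd hd.mdifferentiableAt w).symm.trans hw
    have h3 := eq_zero_of_mfderiv_eq_zero h1 h2
    have h4 : fderiv ℝ (fun u => (looseProj m κ u, looseFiber m κ u)) u w = 0 := by
      rw [mfderiv_eq_fderiv] at h3; exact h3
    refine (injective_iff_map_eq_zero _).1 (injective_looseSplit_fderiv (c := c) hκ hε u) w ?_
    have h5 : HasFDerivAt (looseSplit κ ε c) _ u := hd.hasFDerivAt.prodMk (hhd u).hasFDerivAt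
    rw [h5.fderiv]
    exact Prod.ext h4 hw'
  · obtain ⟨W, hW, hWr⟩ := h.image_open
    rw [inter_univ] at hWr
    -- The image is everything in `SV × ℝ` over `ψ '' O`, because the chart covers entire rays and
    -- all heights.
    refine ⟨{c | c.1.proj ∈ W}, hW.preimage
      ((FiberBundle.continuous_proj _ _).comp continuous_fst), ?_⟩
    rw [← hWr]
    ext e
    constructor
    · rintro ⟨u, hu, rfl⟩
      exact ⟨mem_image_of_mem ψ hu, fiberScale_mem_symplectization (hbS _ hu) _⟩
    · rintro ⟨⟨v, hv, hve⟩, he⟩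
      obtain ⟨r, hr⟩ := exists_eq_fiberScale (hbS v hv) he hve.symm
      have h1 := looseSplit_looseSplitInv (c := c) hκ hε ((v, r), e.2)
      set u := looseSplitInv κ ε c ((v, r), e.2)
      have h2 : looseProj m κ u = v := congrArg (fun p => p.1.1) h1
      have h3 : looseFiber m κ u = r := congrArg (fun p => p.1.2) h1
      have h4 : looseHeight κ ε c u = e.2 := congrArg (fun p => p.2) h1
      refine ⟨u, (h2.symm ▸ hv : looseProj m κ u ∈ O), Prod.ext ?_ h4⟩
      change fiberScale (θ (looseProj m κ u)) (looseFiber m κ u) = e.1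
      rw [h2, h3, hr]
  · have h1 := contactizationForm_apply (canonicalForm d V) (hσd u hu) (hhd u) w
    rw [canonicalForm_mfderiv (hσd u hu)] at h1
    have h2 : mfderiv 𝓘(ℝ, LooseModel (m + 1)) (𝓡 d) (fun y => (σ y).proj) u w =
        mfderiv 𝓘(ℝ, LooseModel m) (𝓡 d) ψ (looseProj m κ u) (looseProj m κ w) := by
      have hψd : MDifferentiableAt 𝓘(ℝ, LooseModel m) (𝓡 d) ψ (looseProj m κ u) :=
        (h.smooth.contMDiffAt (h.isOpen.mem_nhds hu)).mdifferentiableAt (by simp)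
      have h3 : mfderiv 𝓘(ℝ, LooseModel (m + 1)) 𝓘(ℝ, LooseModel m) (looseProj m κ) u w =
          looseProj m κ w := by
        rw [mfderiv_eq_fderiv, ContinuousLinearMap.fderiv]; rfl
      exact (mfderiv_comp_apply u hψd (looseProj m κ).differentiableAt.mdifferentiableAt w).trans
        (congrArg _ h3)
    have h4 : (σ u).2 (mfderiv 𝓘(ℝ, LooseModel (m + 1)) (𝓡 d) (fun y => (σ y).proj) u w) =
        Real.exp (looseFiber m κ u) *
          (ε * stdContactForm (looseProj m κ u) (looseProj m κ w)) := by
      rw [← hb _ hu]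
      exact congrArg (σ u).2 h2
    rw [h4, stdContactForm_looseProj hκ] at h1
    have hε0 : ε ≠ 0 := by rintro rfl; simp at hε
    have h5 : Real.exp (looseFiber m κ u) * ε ≠ 0 := mul_ne_zero (Real.exp_ne_zero _) hε0
    exact (Iff.of_eq (congrArg (· = (0 : ℝ)) h1)).trans (by simp [h5])

end ContactizedChart

/-! ### Transfer of loose charts to the components of the lift -/

section LooseChart

theorem looseBox_eq_prod {m : ℕ} (B : Set (ℝ × ℝ × ℝ)) (ρ : ℝ) :
    (looseBox B ρ : Set (LooseModel m)) =
      B ×ˢ ((univ.pi fun _ => Icc (-ρ) ρ) ×ˢ (univ.pi fun _ => Icc (-ρ) ρ)) := by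
  ext u
  simp only [looseBox, mem_ofPred_eq, mem_prod, mem_univ_pi]

theorem isCompact_looseBox {m : ℕ} {B : Set (ℝ × ℝ × ℝ)} (hB : IsCompact B) (ρ : ℝ) :
    IsCompact (looseBox B ρ : Set (LooseModel m)) := by
  rw [looseBox_eq_prod]
  exact hB.prod ((isCompact_univ_pi fun _ => isCompact_Icc).prod
    (isCompact_univ_pi fun _ => isCompact_Icc))

theorem isPreconnected_looseBox {m : ℕ} {B : Set (ℝ × ℝ × ℝ)} (hB : Convex ℝ B) (ρ : ℝ) :
    IsPreconnected (looseBox B ρ : Set (LooseModel m)) := by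
  rw [looseBox_eq_prod]
  exact hB.isPreconnected.prod ((isPreconnected_univ_pi fun _ => isPreconnected_Icc).prod
    (isPreconnected_univ_pi fun _ => isPreconnected_Icc))

/-- For `m = 0` there are no `x` and `y` coordinates, so the box is independent of `ρ`, and `1 +
|a|` is large enough for the action bound. -/
theorem exists_looseBox_subset (m : ℕ) (B : Set (ℝ × ℝ × ℝ)) {a ρ : ℝ} (hρ : 0 < ρ)
    (ha : 1 ≤ m → a / ρ ^ 2 < 2) :
    ∃ ρ', 0 < ρ' ∧ a / ρ' ^ 2 < 2 ∧
      (looseBox B ρ' : Set (LooseModel m)) ⊆ looseBox B ρ := by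
  rcases Nat.eq_zero_or_pos m with rfl | hm
  · refine ⟨1 + |a|, by positivity, ?_, fun u hu => ⟨hu.1, fun i => i.elim0, fun i => i.elim0⟩⟩
    rw [div_lt_iff₀ (by positivity)]
    nlinarith [le_abs_self a, abs_nonneg a, sq_nonneg (|a|)]
  · exact ⟨ρ, hρ, ha hm, Subset.rfl⟩

variable {d : ℕ} {V : Type*} [TopologicalSpace V] [ChartedSpace (EuclideanSpace ℝ (Fin d)) V]
  [IsManifold (𝓡 d) ∞ V] {ξ : CoorientedContactStructure d V} {m : ℕ}

/-- A loose chart can be chosen to preserve or to reverse the coorientation. -/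
theorem IsContactParam.exists_isPositiveAt_iff {O : Set (LooseModel m)} {ψ : LooseModel m → V}
    (h : IsContactParam (𝓡 d) univ ξ.plane m O ψ) {T : Set (LooseModel m)}
    (hT : IsPreconnected T) (hTO : T ⊆ O) :
    ∃ (ε : ℝ) (O' : Set (LooseModel m)), (ε = 1 ∨ ε = -1) ∧ T ⊆ O' ∧ O' ⊆ O ∧ IsOpen O' ∧
      ∀ u ∈ O', IsPositiveAt ξ ψ u ↔ 0 < ε := by
  classical
  rcases T.eq_empty_or_nonempty with rfl | ⟨u₀, hu₀⟩
  · exact ⟨1, ∅, Or.inl rfl, Subset.rfl, empty_subset _, isOpen_empty, by simp⟩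
  -- The sign is locally constant on `O`, so it is constant on the preconnected set `T`; the new
  -- domain is the open locus with that sign.
  refine ⟨if IsPositiveAt ξ ψ u₀ then 1 else -1,
    {u | u ∈ O ∧ IsPositiveAt ξ ψ u = IsPositiveAt ξ ψ u₀}, by split_ifs <;> simp,
    fun u hu => ⟨hTO hu, hT.eq_of_eventually_eq hTO (fun u hu => h.eventually_isPositiveAt hu)
      hu hu₀⟩, fun u hu => hu.1, ?_, ?_⟩
  · rw [isOpen_iff_mem_nhds]
    rintro u ⟨hu, hu'⟩
    have h1 := h.eventually_isPositiveAt hu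
    rw [h.isOpen.nhdsWithin_eq hu] at h1
    filter_upwards [h1, h.isOpen.mem_nhds hu] with y hy hyO
    exact ⟨hyO, hy.trans hu'⟩
  · rintro u ⟨-, hu⟩
    rw [hu]
    split_ifs with h0 <;> simp [h0]

/-- Here `C₀` is the part of the lift over the component `Λ₀`, at the constant height `c`, and `C₁`
is the rest of the lift, lying over `A`. -/
theorem HasLooseChart.contactization {Λ₀ A : Set V}
    (h : HasLooseChart (𝓡 d) univ ξ.plane m Λ₀ A) {c : ℝ} {C₀ C₁ : Set (CotangentTotal d V × ℝ)}
    (hC₀ : ∀ e : CotangentTotal d V × ℝ, e.1 ∈ symplectization ξ →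
      (e ∈ C₀ ↔ e.1.proj ∈ Λ₀ ∧ e.2 = c))
    (hC₁ : ∀ e ∈ C₁, e.1.proj ∈ A) :
    HasLooseChart ((cotangentModel d).prod 𝓘(ℝ, ℝ)) (contactization (symplectization ξ))
      (contactizationPlane (cotangentModel d) (canonicalForm d V)) (m + 1) C₀ C₁ := by
  obtain ⟨B, p, q, z, a, ρ₀, O₀, ψ, hB, hst, harc, hρ₀, ha₀, hψ₀, hbox₀, hdisj, hΛ⟩ := h
  obtain ⟨ρ, hρ, ha, hρsub⟩ := exists_looseBox_subset m B hρ₀ ha₀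
  obtain ⟨ε, O, hε, hbox, hOO, hO, hpos⟩ := hψ₀.exists_isPositiveAt_iff
    (isPreconnected_looseBox hB.1 ρ) (hρsub.trans hbox₀)
  have hψ := hψ₀.mono hO hOO
  obtain ⟨b, hbs, hb⟩ := hψ.exists_covector_lift hε hpos
  obtain ⟨δ, hδ, hthick⟩ := (isCompact_looseBox hB.2.1 ρ).exists_thickening_subset_open hO hbox
  have hεε : ε * ε = 1 := by rcases hε with rfl | rfl <;> norm_num
  have hε0 : ε ≠ 0 := by rintro rfl; simp at hεε
  -- With `|y₀| ≤ ρ` the shift `κ y₀` is at most `δ / 2`, so the projected box stays in the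
  -- `δ`-thickening of the old one, inside `O`.
  set κ : ℝ := δ / (2 * ρ) with hκ
  have hκ0 : 0 < κ := by positivity
  have hsub : (looseBox B ρ : Set (LooseModel (m + 1))) ⊆ looseProj m κ ⁻¹' O := by
    rintro u ⟨hu1, hu2, hu3⟩
    refine hthick (Metric.mem_thickening_iff.2 ⟨(u.1, fun i => u.2.1 i.succ, fun i => u.2.2 i.succ),
      ⟨hu1, fun i => hu2 _, fun i => hu3 _⟩, ?_⟩)
    have h1 : |u.2.2 0| ≤ ρ := abs_le.2 (hu3 0)
    have h2 : κ * |u.2.2 0| < δ := by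
      calc κ * |u.2.2 0| ≤ κ * ρ := by gcongr
        _ = δ / 2 := by rw [hκ]; field_simp
        _ < δ := by linarith
    have h3 : dist (u.1.2.2 - κ * u.2.2 0) u.1.2.2 = κ * |u.2.2 0| := by
      rw [Real.dist_eq, sub_sub_cancel_left, abs_neg, abs_mul, abs_of_pos hκ0]
    rw [looseProj_apply]
    simp only [Prod.dist_eq, dist_self, h3]
    simp [h2, hδ]
  refine ⟨B, p, q, z, a, ρ, looseProj m κ ⁻¹' O, contactizedChart ψ b κ ε c, hB, hst, harc, hρ,
    fun _ => ha, hψ.contactizedChart hκ0.ne' hεε c hbs (fun u hu => (hb u hu).1)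
      (fun u hu => (hb u hu).2), hsub, ?_, ?_⟩
  · rw [Set.disjoint_left]
    rintro _ ⟨u, hu, rfl⟩ hu'
    exact Set.disjoint_left.1 hdisj (mem_image_of_mem ψ (hOO hu)) (hC₁ _ hu')
  · intro u hu
    have hheight : looseHeight κ ε c u = c ↔ u.2.2 0 = 0 := by
      simp [looseHeight, hε0, hκ0.ne', Real.exp_ne_zero]
    rw [hC₀ _ (fiberScale_mem_symplectization (hb _ (hsub hu)).1 _)]
    change ψ (looseProj m κ u) ∈ Λ₀ ∧ looseHeight κ ε c u = c ↔ _
    rw [hheight]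
    have hy : u.2.2 = 0 ↔ u.2.2 0 = 0 ∧ (fun i : Fin m => u.2.2 i.succ) = 0 := by
      rw [funext_iff, funext_iff, Fin.forall_fin_succ]; rfl
    rw [hy]
    -- On `y₀ = 0` the shift vanishes, so the projected point lies in the old box itself, where the
    -- shape of `Λ₀` is known; elsewhere in the thickening it is not.
    have key : u.2.2 0 = 0 → (ψ (looseProj m κ u) ∈ Λ₀ ↔
        (u.1 ∈ arcImage p q z ∧ (fun i : Fin m => u.2.2 i.succ) = 0)) := by
      intro h0
      have h1 : looseProj m κ u = (u.1, fun i => u.2.1 i.succ, fun i => u.2.2 i.succ) := by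
        rw [looseProj_apply, h0, mul_zero, sub_zero]
      rw [h1]
      exact hΛ _ (hρsub ⟨hu.1, fun i => hu.2.1 _, fun i => hu.2.2 _⟩)
    constructor
    · rintro ⟨h1, h0⟩
      exact ⟨((key h0).1 h1).1, h0, ((key h0).1 h1).2⟩
    · rintro ⟨h1, h0, h2⟩
      exact ⟨(key h0).2 ⟨h1, h2⟩, h0⟩

theorem ComponentsHaveLooseCharts.contactization {M : Set V} {j : ℕ} {Λ : Set V}
    (hΛ : IsLegendrian (𝓡 d) M ξ.plane j Λ)
    (h : ComponentsHaveLooseCharts (𝓡 d) univ ξ.plane m Λ) {k : ℕ} {f : CotangentTotal d V → ℝ}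
    (hf : IsPrimitiveOn (cotangentModel d) (fun c => -canonicalForm d V c) k
      (symplectizationLift ξ Λ) f) {C : Set (CotangentTotal d V × ℝ)}
    (hC : C = {c | c.1 ∈ symplectizationLift ξ Λ ∧ c.2 = f c.1}) :
    ComponentsHaveLooseCharts ((cotangentModel d).prod 𝓘(ℝ, ℝ))
      (_root_.contactization (symplectization ξ))
      (contactizationPlane (cotangentModel d) (canonicalForm d V)) (m + 1) C := by
  intro e₀ he₀
  have hev := fun c hc => IsPrimitiveOn.eventually_eq hΛ hf (c := c) hc
  have he₀' := he₀
  rw [hC] at he₀'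
  have hcomp := connectedComponentIn_graph ξ hev hC he₀
  have hsub : connectedComponentIn Λ e₀.1.proj ⊆ Λ := connectedComponentIn_subset _ _
  -- The primitive is locally constant and the lift of a component is connected, so a whole
  -- component of the graph sits at one height.
  have hconst : ∀ c ∈ symplectizationLift ξ (connectedComponentIn Λ e₀.1.proj),
      f c = f e₀.1 := fun c hc =>
    (isPreconnected_symplectizationLift ξ isPreconnected_connectedComponentIn).eq_of_eventually_eq
      (S := symplectizationLift ξ Λ) (fun c hc => ⟨hc.1, hsub hc.2⟩) hev hc
      ⟨he₀'.1.1, mem_connectedComponentIn he₀'.1.2⟩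
  refine (h e₀.1.proj he₀'.1.2).contactization (c := f e₀.1) (fun e he => ?_) fun e he => ?_
  · rw [hcomp]
    constructor
    · rintro ⟨h1, h2⟩
      rw [hC] at h1
      exact ⟨h2, h1.2.trans (hconst _ ⟨he, h2⟩)⟩
    · rintro ⟨h1, h2⟩
      refine ⟨?_, h1⟩
      rw [hC]
      exact ⟨⟨he, hsub h1⟩, h2.trans (hconst _ ⟨he, h1⟩).symm⟩
  · rw [hcomp] at he
    have h1 := he.1
    rw [hC] at h1
    exact ⟨h1.1.2, fun h2 => he.2 ⟨he.1, h2⟩⟩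

end LooseChart

end

theorem mainTheorem8 (m : ℕ) {V : Type*} [TopologicalSpace V] [T2Space V]
    [SecondCountableTopology V] [ChartedSpace (EuclideanSpace ℝ (Fin (2 * m + 3))) V]
    [IsManifold (𝓡 (2 * m + 3)) ∞ V] (ξ : CoorientedContactStructure (2 * m + 3) V)
    (Λ : Set V)
    (hΛ : IsLoose (𝓡 (2 * m + 3)) univ ξ.plane m Λ ∨
      (m = 0 ∧ IsStabilized (𝓡 (2 * m + 3)) univ ξ.plane Λ)) :
    (∃ C, IsLegendrianLift (cotangentModel (2 * m + 3)) (canonicalForm (2 * m + 3) V)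
      (symplectization ξ) (m + 2) (symplectizationLift ξ Λ) C) ∧
    ∀ C, IsLegendrianLift (cotangentModel (2 * m + 3)) (canonicalForm (2 * m + 3) V)
        (symplectization ξ) (m + 2) (symplectizationLift ξ Λ) C →
      IsLoose ((cotangentModel (2 * m + 3)).prod 𝓘(ℝ, ℝ)) (contactization (symplectization ξ))
        (contactizationPlane (cotangentModel (2 * m + 3)) (canonicalForm (2 * m + 3) V))
        (m + 1) C := by
  -- Both hypotheses give the same data, since the chart condition already drops the action bound
  -- when `m = 0`.
  have hL : IsLegendrian (𝓡 (2 * m + 3)) univ ξ.plane (m + 1) Λ ∧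
      ComponentsHaveLooseCharts (𝓡 (2 * m + 3)) univ ξ.plane m Λ := by
    rcases hΛ with h | ⟨rfl, h⟩
    · exact h.2
    · exact h
  have hsub : symplectizationLift ξ Λ ⊆ symplectization ξ := fun c hc => hc.1
  refine ⟨⟨_, hsub, fun _ => 0, hL.1.isPrimitiveOn_zero, rfl⟩, ?_⟩
  rintro C ⟨-, f, hf, hC⟩
  exact ⟨by omega, isLegendrian_of_isPrimitiveOn hsub hf hC, hL.2.contactization hL.1 hf hC⟩
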